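/- Let $(M,g)$ and $(\hat M,\hat g)$ be connected complete real analytic Riemannian manifolds of the same dimension $d$ (the manifolds and the metrics are real analytic), let $\exp^g_p$ denote the exponential map at $p$, let $B_g(p,r)$ denote the open metric ball, and let the injectivity radius $\mathrm{inj}_g(p)\in(0,\infty]$ be the supremum of all $r>0$ such that $\exp^g_p$ maps the open ball of radius $r$ in $(T_pM,g_p)$ diffeomorphically onto $B_g(p,r)$. For an ordered orthonormal basis $\beta=(E_1,\dots,E_d)$ of $(T_pM,g_p)$ let $L_\beta:\mathbb R^d\to T_pM$ be the linear isometry with $L_\beta(e_k)=E_k$, and put $\phi_\beta:=\exp^g_p\circ L_\beta$, which restricts to a diffeomorphism from $B_{\mathbb R^d}(0,\mathrm{inj}_g(p))$ onto $B_g(p,\mathrm{inj}_g(p))$; $\phi_\beta^{-1}$ denotes the inverse of this restriction. Let $S_g(\beta)$ be the Taylor series at $0\in\mathbb R^d$ of $\phi_\beta^*g$, viewed as a map into the symmetric $d\times d$ matrices. For orthonormal bases $\beta_1,\beta_2$ at points $p_1,p_2$ with $\mathrm{dist}_g(p_1,p_2)<\mathrm{inj}_g(p_1)$ let $T_g(\beta_1,\beta_2)$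 be the Taylor series at $0\in\mathbb R^d$ of $\phi_{\beta_1}^{-1}\circ\phi_{\beta_2}$. Use the same notation on $(\hat M,\hat g)$. Let $\beta_1,\dots,\beta_m$ be ordered orthonormal bases of the tangent spaces at $p_1,\dots,p_m\in M$, let $\hat\beta_1,\dots,\hat\beta_m$ be ordered orthonormal bases of the tangent spaces at $\hat p_1,\dots,\hat p_m\in\hat M$, and let $$0<\delta<\tfrac12\min_{1\le j\le m}\bigl\{\mathrm{inj}_g(p_j),\ \mathrm{inj}_{\hat g}(\hat p_j)\bigr\}.$$ Assume that (a) $p_1,\dots,p_m$ are pairwise distinct and $\hat p_1,\dots,\hat p_m$ are pairwise distinct; (b) $S_g(\beta_i)=S_{\hat g}(\hat\beta_i)$ for $i=1,\dots,m$; (c) for all $i,j$, $B_g(p_i,\delta)\cap B_g(p_j,\delta)\ne\emptyset$ if and only if $B_{\hat g}(\hat p_i,\delta)\cap B_{\hat g}(\hat p_j,\delta)\ne\emptyset$, and in this case $T_g(\beta_i,\beta_j)=T_{\hat g}(\hat\beta_i,\hat\beta_j)$. Then each $f_i:=\phi_{\hat\beta_i}\circ\phi_{\beta_i}^{-1}$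 maps $B_g(p_i,\delta)$ onto $B_{\hat g}(\hat p_i,\delta)$, and the $f_i$ glue to a well-defined local isometry from $\bigcup_{i=1}^m B_g(p_i,\delta)$ onto $\bigcup_{i=1}^m B_{\hat g}(\hat p_i,\delta)$; that is, there is a map $f$ on $\bigcup_i B_g(p_i,\delta)$ with $f=f_i$ on $B_g(p_i,\delta)$ for every $i$, which is smooth, satisfies $f^*\hat g=g$, and has image $\bigcup_i B_{\hat g}(\hat p_i,\delta)$. -/

import Mathlib

open scoped Manifold ContDiff Topology ENNReal Nat
open Bundle

noncomputable section

namespace RiemGeom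

section Euclidean

/-- The Taylor series expansion at `0` of a (smooth) map `f : ℝᵈ → V`, that is, the formal power
series whose homogeneous part of degree `n` is `(1 / n!) Dⁿf(0)`. -/
def taylorSeries {d : ℕ} {V : Type*} [NormedAddCommGroup V] [NormedSpace ℝ V]
    (f : EuclideanSpace ℝ (Fin d) → V) :
    FormalMultilinearSeries ℝ (EuclideanSpace ℝ (Fin d)) V :=
  fun n => ((n ! : ℝ)⁻¹) • iteratedFDeriv ℝ n f 0

/-- The partial derivative `∂ᵢ h` at `y` of a real-valued function on `ℝᵈ`. -/
def partialDeriv {d : ℕ} (i : Fin d) (h : EuclideanSpace ℝ (Fin d) → ℝ)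
    (y : EuclideanSpace ℝ (Fin d)) : ℝ :=
  fderiv ℝ h y (EuclideanSpace.single i 1)

/-- The Christoffel symbol `Γᵏᵢⱼ` at `y` of a metric `G = (Gᵢⱼ)` given in coordinates:
`Γᵏᵢⱼ = ½ ∑ₗ Gᵏˡ (∂ᵢ Gⱼₗ + ∂ⱼ Gᵢₗ - ∂ₗ Gᵢⱼ)`, where `(Gᵏˡ)` is the inverse matrix. -/
def christoffel {d : ℕ} (G : EuclideanSpace ℝ (Fin d) → Fin d → Fin d → ℝ)
    (k i j : Fin d) (y : EuclideanSpace ℝ (Fin d)) : ℝ :=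
  (1 / 2) * ∑ l : Fin d, (Matrix.of (G y))⁻¹ k l *
    (partialDeriv i (fun z => G z j l) y + partialDeriv j (fun z => G z i l) y
      - partialDeriv l (fun z => G z i j) y)

end Euclidean

section Manifold

variable {d : ℕ} {M : Type*} [MetricSpace M] [ChartedSpace (EuclideanSpace ℝ (Fin d)) M]
  [IsManifold (𝓡 d) ω M] [RiemannianBundle (fun x : M => TangentSpace (𝓡 d) x)]

/-- The pullback `ψ^* g` of the Riemannian metric `g` of `M` under a map `ψ` from (an open subset
of) `ℝᵈ` to `M`, as a matrix-valued function on `ℝᵈ`: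
`(ψ^* g)ᵢⱼ (y) = g (dψ_y eᵢ, dψ_y eⱼ)`. -/
def pullbackMetric (ψ : EuclideanSpace ℝ (Fin d) → M) (y : EuclideanSpace ℝ (Fin d))
    (i j : Fin d) : ℝ :=
  inner ℝ
    (mfderiv (𝓡 d) (𝓡 d) ψ y (EuclideanSpace.single i 1) : TangentSpace (𝓡 d) (ψ y))
    (mfderiv (𝓡 d) (𝓡 d) ψ y (EuclideanSpace.single j 1) : TangentSpace (𝓡 d) (ψ y))

variable (d) in
/-- A curve `γ : ℝ → M` is a geodesic if it is smooth and in local coordinates `(c₁, …, c_d)`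
satisfies `cₖ'' + ∑ᵢⱼ Γᵏᵢⱼ(c) cᵢ' cⱼ' = 0`. -/
def IsGeodesic (γ : ℝ → M) : Prop :=
  ContMDiff 𝓘(ℝ, ℝ) (𝓡 d) ∞ γ ∧
  ∀ (x₀ : M) (t : ℝ), γ t ∈ (extChartAt (𝓡 d) x₀).source →
    ∀ k : Fin d,
      iteratedDeriv 2 (fun s => extChartAt (𝓡 d) x₀ (γ s) k) t
        + ∑ i : Fin d, ∑ j : Fin d,
            christoffel (pullbackMetric (M := M) (extChartAt (𝓡 d) x₀).symm) k i j
                (extChartAt (𝓡 d) x₀ (γ t))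
              * deriv (fun s => extChartAt (𝓡 d) x₀ (γ s) i) t
              * deriv (fun s => extChartAt (𝓡 d) x₀ (γ s) j) t = 0

/-- `γ : ℝ → M` is a geodesic with `γ(0) = p` and `γ'(0) = v`. -/
def IsGeodesicFrom (p : M) (v : TangentSpace (𝓡 d) p) (γ : ℝ → M) : Prop :=
  IsGeodesic d γ ∧
    tangentMap 𝓘(ℝ, ℝ) (𝓡 d) γ ⟨0, (1 : ℝ)⟩ = (⟨p, v⟩ : TangentBundle (𝓡 d) M)

open Classical in
/-- The exponential map at `p`: `exp_p(v) = γ(1)`, where `γ` is the geodesic with `γ(0) = p` and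
`γ'(0) = v`. (In a complete manifold it exists and is unique; the default value is `p`.) -/
def expMap (p : M) (v : TangentSpace (𝓡 d) p) : M :=
  if h : ∃ γ : ℝ → M, IsGeodesicFrom p v γ then h.choose 1 else p

variable (d) in
/-- The map `exp_p : B_{T_p M}(0, r) → B(p, r)` is a (smooth) diffeomorphism. -/
def IsExpDiffeo (p : M) (r : ℝ) : Prop :=
  ∃ Φ : PartialDiffeomorph 𝓘(ℝ, TangentSpace (𝓡 d) p) (𝓡 d) (TangentSpace (𝓡 d) p) M ∞,
    Φ.source = Metric.ball (0 : TangentSpace (𝓡 d) p) r ∧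
    Φ.target = Metric.ball p r ∧
    Set.EqOn (expMap p) Φ (Metric.ball (0 : TangentSpace (𝓡 d) p) r)

variable (d) in
/-- The injectivity radius at `p`: the supremum (possibly `∞`) of all `r > 0` such that
`exp_p : B_{T_p M}(0, r) → B(p, r)` is a diffeomorphism. -/
def injRad (p : M) : ℝ≥0∞ :=
  sSup (ENNReal.ofReal '' {r : ℝ | 0 < r ∧ IsExpDiffeo d p r})

variable (d M) in
/-- A point of the orthonormal frame bundle of `M`: a base point `p` together with an ordered
orthonormal basis of `T_p M`. -/
structure Frame where
  pt : M
  basis : OrthonormalBasis (Fin d) ℝ (TangentSpace (𝓡 d) pt)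

/-- The map `exp_p ∘ L_β : ℝᵈ → M`, where `L_β : ℝᵈ → T_p M` is the linear isometry sending the
standard basis to the frame `β`. -/
def normalMap (β : Frame d M) (x : EuclideanSpace ℝ (Fin d)) : M :=
  expMap β.pt (β.basis.repr.symm x)

/-- Normal coordinates: the inverse `(exp_p ∘ L_β)⁻¹` of the bijection
`exp_p ∘ L_β : B(0, injRad p) → B(p, injRad p)`. -/
def normalCoord (β : Frame d M) : M → EuclideanSpace ℝ (Fin d) :=
  Function.invFunOn (normalMap β)
    {x : EuclideanSpace ℝ (Fin d) | ENNReal.ofReal ‖x‖ < injRad d β.pt}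

/-- `S_g(β)`: the Taylor series at `0` of the metric in the normal coordinates given by `β`. -/
def metricSeries (β : Frame d M) :
    FormalMultilinearSeries ℝ (EuclideanSpace ℝ (Fin d)) (Fin d → Fin d → ℝ) :=
  taylorSeries (pullbackMetric (normalMap β))

/-- `T_g(β₁, β₂)`: the Taylor series at `0` of the transition map
`(exp_{p₁} ∘ L_{β₁})⁻¹ ∘ (exp_{p₂} ∘ L_{β₂})`, meaningful when `dist p₁ p₂ < injRad p₁`. -/
def transitionSeries (β₁ β₂ : Frame d M) :
    FormalMultilinearSeries ℝ (EuclideanSpace ℝ (Fin d)) (EuclideanSpace ℝ (Fin d)) :=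
  taylorSeries (normalCoord β₁ ∘ normalMap β₂)

variable {N : Type*} [MetricSpace N] [ChartedSpace (EuclideanSpace ℝ (Fin d)) N]
  [IsManifold (𝓡 d) ω N] [RiemannianBundle (fun x : N => TangentSpace (𝓡 d) x)]

variable (d) in
/-- `f` is a local isometry on the open set `U`: it is smooth there and `f^* h = g`. -/
def IsLocalIsometryOn (f : M → N) (U : Set M) : Prop :=
  ContMDiffOn (𝓡 d) (𝓡 d) ∞ f U ∧
  ∀ x ∈ U, ∀ v w : TangentSpace (𝓡 d) x,
    inner ℝ (mfderiv (𝓡 d) (𝓡 d) f x v : TangentSpace (𝓡 d) (f x))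
        (mfderiv (𝓡 d) (𝓡 d) f x w : TangentSpace (𝓡 d) (f x))
      = inner ℝ v w

/-- The map `(exp_{p̂} ∘ L_{β̂}) ∘ (exp_p ∘ L_β)⁻¹`, expressing the correspondence of the normal
coordinates given by `β` and by `β̂`. -/
def normalCorrespondence (β : Frame d M) (β' : Frame d N) : M → N :=
  normalMap β' ∘ normalCoord β

end Manifold

end RiemGeom

end

/-!
Write `φ_β = exp_p ∘ L_β` for the normal coordinates of a frame `β` at `p`.

**The metric in normal coordinates is determined by its Taylor series.** Along a geodesic
`t ↦ φ_β (t v)` the vectors `dφ_β (t v) (t w)` form a Jacobi field. Geodesics and their variation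
fields solve ordinary differential equations with analytic coefficients, hence they are analytic
(`AnalyticODE.analyticAt_of_hasDerivAt`, `AnalyticODE.analyticAt_variation`), so
`t ↦ t² (φ_β^* g) (t v) (w, w')` is analytic as long as `t v` lies in a ball on which the
exponential map is a diffeomorphism. If two such metrics have the same Taylor series at the origin,
then the difference of these functions vanishes to infinite order at `t = 0`, and therefore
identically (`RiemGeom.pullbackForm_normalMap_eq`). Analyticity of the exponential map as
a function of several variables is not needed. Consequently each `f_i = φ_{β'_i} ∘ φ_{β_i}⁻¹` is a local isometry.

**Balls are mapped onto balls.** A path of length less than `δ` issued from `p_i` is mapped by `f_i`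
to a path of the same length. The image path cannot leave the range of the normal coordinates of
`β'_i`: at a first exit time it has a limit by completeness, the distance of this limit to `p'_i` is
at most the length of the path, so the limit still lies in the ball where normal coordinates are
defined (`RiemGeom.path_mem_commonDomain`). Hence `f_i` does not increase the distance to the base
point, and the same holds for its inverse (`RiemGeom.image_normalCorrespondence_ball`).

**The maps agree on overlaps.** A map `F` with `F^* H = G` satisfies a second order equation, given
by the Koszul formula, which determines it from its 1-jet at a point
(`MetricRigidity.eventuallyEq_of_pullForm_eq`). If the balls around `p_i` and `p_j` meet, the
equality of the Taylor series of the transition maps says in particular that `φ_{β'_j}` and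
`f_i ∘ φ_{β_j}` have the same 1-jet at the origin, so that `f_j` and `f_i` agree near `p_j`.
A path of length less than `δ` from `p_j` to a common point `q` of the balls stays within
distance `2 δ` of `p_i` and `p_j`, where both maps are isometric; by propagation along this path they agree at `q`
(`RiemGeom.normalCorrespondence_eq_of_mem_inter`).
-/

noncomputable section

/-! ### Analyticity of solutions of analytic differential equations -/

namespace AnalyticODE

open Set Filter

variable {E F : Type*} [NormedAddCommGroup E] [NormedSpace ℝ E] [NormedAddCommGroup F]
  [NormedSpace ℝ F] {K : Type*} [TopologicalSpace K] [CompactSpace K]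

variable (K) in
/-- The continuous multilinear map on `C(K, E)` obtained by applying a continuous multilinear map
on `E` pointwise. -/
def pointwiseMultilinear {n : ℕ} (q : E [×n]→L[ℝ] F) : C(K, E) [×n]→L[ℝ] C(K, F) :=
  MultilinearMap.mkContinuous
    { toFun := fun h => ⟨fun s => q (fun i => h i s),
        q.cont.comp (continuous_pi fun i => (h i).continuous)⟩
      map_update_add' := by
        intro _ m i x y
        ext s
        have (z : C(K, E)) : (fun j => (Function.update m i z) j s)
            = Function.update (fun j => m j s) i (z s) := by
          ext j
          by_cases h : j = i
          · subst h; simp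
          · simp [h]
        simp [this]
      map_update_smul' := by
        intro _ m i c x
        ext s
        have (z : C(K, E)) : (fun j => (Function.update m i z) j s)
            = Function.update (fun j => m j s) i (z s) := by
          ext j
          by_cases h : j = i
          · subst h; simp
          · simp [h]
        simp [this] } ‖q‖
    (by
      intro m
      refine (ContinuousMap.norm_le _ (by positivity)).2 fun s => ?_
      refine (q.le_opNorm _).trans ?_
      gcongr with i
      exact (m i).norm_coe_le_norm s)

lemma pointwiseMultilinear_apply {n : ℕ} (q : E [×n]→L[ℝ] F) (h : Fin n → C(K, E)) (s : K) :
    pointwiseMultilinear K q h s = q (fun i => h i s) := rfl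

lemma norm_pointwiseMultilinear_le {n : ℕ} (q : E [×n]→L[ℝ] F) :
    ‖pointwiseMultilinear K q‖ ≤ ‖q‖ :=
  MultilinearMap.mkContinuous_norm_le _ (norm_nonneg _) _

variable (K) in
/-- Superposition with an analytic map is analytic on `C(K, E)`: near the zero function,
`h ↦ (s ↦ X (x₀ + h s))` is given by the pointwise power series of `X`. -/
lemma exists_analyticAt_superposition [CompleteSpace F] {X : E → F} {x₀ : E}
    (hX : AnalyticAt ℝ X x₀) :
    ∃ S : C(K, E) → C(K, F), AnalyticAt ℝ S 0 ∧
      ∀ᶠ h in 𝓝 (0 : C(K, E)), ∀ s, S h s = X (x₀ + h s) := by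
  obtain ⟨p, r, hp⟩ := hX
  let P : FormalMultilinearSeries ℝ C(K, E) C(K, F) := fun n => pointwiseMultilinear K (p n)
  have hrad : p.radius ≤ P.radius := by
    refine ENNReal.le_of_forall_nnreal_lt fun t ht => ?_
    obtain ⟨C, -, hC⟩ := p.norm_mul_pow_le_of_lt_radius ht
    refine P.le_radius_of_bound C fun n => le_trans ?_ (hC n)
    gcongr
    exact norm_pointwiseMultilinear_le _
  have hr : 0 < P.radius := hp.r_pos.trans_le (hp.r_le.trans hrad)
  have hP := P.hasFPowerSeriesOnBall hr
  refine ⟨P.sum, hP.analyticAt, ?_⟩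
  have hball : Metric.eball (0 : C(K, E)) r ∈ 𝓝 (0 : C(K, E)) := Metric.eball_mem_nhds _ hp.r_pos
  filter_upwards [hball] with h hh s
  have h1 := hP.hasSum (y := h) (Metric.eball_subset_eball (hp.r_le.trans hrad) hh)
  have h2 := h1.map (ContinuousMap.evalCLM ℝ s) (ContinuousMap.evalCLM ℝ s).continuous
  have h3 := hp.hasSum (y := h s) (by
    rw [Metric.mem_eball, edist_zero_right] at hh ⊢
    refine lt_of_le_of_lt ?_ hh
    rw [enorm_le_iff_norm_le]
    exact h.norm_coe_le_norm s)
  have h4 : HasSum (fun n => p n fun _ => h s) ((P.sum h) s) := by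
    simpa [Function.comp_def, P, pointwiseMultilinear_apply] using h2
  exact h4.unique h3

/-- The primitive vanishing at `0`, as a continuous linear operator on `C([0, 1], E)`. -/
def primitive [CompleteSpace E] : C(unitInterval, E) →L[ℝ] C(unitInterval, E) :=
  LinearMap.mkContinuous
    { toFun := fun f => ⟨fun s => ∫ τ in (0 : ℝ)..s, IccExtend zero_le_one f τ, by
          have hf : Continuous (IccExtend (zero_le_one (α := ℝ)) f) := f.continuous.Icc_extend'
          have := intervalIntegral.continuous_primitive (μ := MeasureTheory.volume)
            (fun a b => hf.intervalIntegrable a b) 0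
          exact this.comp continuous_subtype_val⟩
      map_add' := by
        intro f g
        ext s
        have hf : Continuous (IccExtend (zero_le_one (α := ℝ)) f) := f.continuous.Icc_extend'
        have hg : Continuous (IccExtend (zero_le_one (α := ℝ)) g) := g.continuous.Icc_extend'
        simp only [ContinuousMap.coe_mk, ContinuousMap.add_apply]
        rw [← intervalIntegral.integral_add (hf.intervalIntegrable _ _) (hg.intervalIntegrable _ _)]
        rfl
      map_smul' := by
        intro c f
        ext s
        simp only [ContinuousMap.coe_mk, ContinuousMap.smul_apply, RingHom.id_apply]
        rw [← intervalIntegral.integral_smul]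
        rfl } 1
    (by
      intro f
      rw [one_mul]
      refine (ContinuousMap.norm_le _ (norm_nonneg _)).2 fun s => ?_
      refine (intervalIntegral.norm_integral_le_of_norm_le_const (C := ‖f‖)
        fun τ _ => f.norm_coe_le_norm _).trans ?_
      have h0 := s.2.1
      have h1 := s.2.2
      rw [sub_zero, abs_of_nonneg h0]
      exact mul_le_of_le_one_right (norm_nonneg _) h1)

lemma primitive_apply [CompleteSpace E] (f : C(unitInterval, E)) (s : unitInterval) :
    primitive f s = ∫ τ in (0 : ℝ)..s, IccExtend zero_le_one f τ := rfl

/-- A solution `x = k l` of `x = l • T x` that is continuous at `l = 0` depends analytically on `l`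
there, by the analytic inverse function theorem for `(l, x) ↦ (l, x - l • T x)`. -/
lemma analyticAt_of_eventually_fixedPoint {V : Type*} [NormedAddCommGroup V] [NormedSpace ℝ V]
    [CompleteSpace V] {T : V → V} (hT : AnalyticAt ℝ T 0) {k : ℝ → V} (hk : Tendsto k (𝓝 0) (𝓝 0))
    (hfix : ∀ᶠ l in 𝓝 (0 : ℝ), k l = l • T (k l)) : AnalyticAt ℝ k 0 := by
  let Ψ : ℝ × V → ℝ × V := fun x => (x.1, x.2 - x.1 • T x.2)
  have hk0 : k 0 = 0 := by simpa using hfix.self_of_nhds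
  have hTs : AnalyticAt ℝ (fun x : ℝ × V => T x.2) (0, 0) :=
    AnalyticAt.comp_of_eq hT analyticAt_snd rfl
  have hΨ : AnalyticAt ℝ Ψ (0, 0) :=
    analyticAt_fst.prod (analyticAt_snd.sub (analyticAt_fst.smul hTs))
  let A : (ℝ × V) ≃L[ℝ] (ℝ × V) := ContinuousLinearEquiv.equivOfInverse
    ((ContinuousLinearMap.fst ℝ ℝ V).prod (ContinuousLinearMap.snd ℝ ℝ V
      - (ContinuousLinearMap.fst ℝ ℝ V).smulRight (T 0)))
    ((ContinuousLinearMap.fst ℝ ℝ V).prod (ContinuousLinearMap.snd ℝ ℝ V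
      + (ContinuousLinearMap.fst ℝ ℝ V).smulRight (T 0)))
    (by intro x; ext <;> simp) (by intro x; ext <;> simp)
  have hd : HasFDerivAt Ψ (A : (ℝ × V) →L[ℝ] (ℝ × V)) (0, 0) := by
    have h1 : HasFDerivAt (fun x : ℝ × V => x.1) (ContinuousLinearMap.fst ℝ ℝ V) (0, 0) :=
      hasFDerivAt_fst
    have h2 : HasFDerivAt (fun x : ℝ × V => x.2) (ContinuousLinearMap.snd ℝ ℝ V) (0, 0) :=
      hasFDerivAt_snd
    have h3 := h1.prodMk (h2.sub (h1.smul hTs.differentiableAt.hasFDerivAt))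
    refine h3.congr_fderiv ?_
    ext x <;> simp [A, ContinuousLinearEquiv.equivOfInverse]
  have hc : ContDiffAt ℝ ω Ψ (0, 0) := hΨ.contDiffAt
  have hn : (ω : WithTop ℕ∞) ≠ 0 := by simp
  let Φ := hc.toOpenPartialHomeomorph Ψ hd hn
  have hinv : ContDiffAt ℝ ω Φ.symm (Ψ (0, 0)) := hc.to_localInverse hd hn
  have hΨ0 : Ψ (0, 0) = (0, 0) := by simp [Ψ]
  rw [hΨ0] at hinv
  have hinv' : AnalyticAt ℝ Φ.symm (0, 0) := hinv.analyticAt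
  have hcomp : AnalyticAt ℝ (fun l : ℝ => (Φ.symm (l, 0)).2) 0 := by
    have h1 : AnalyticAt ℝ (fun l : ℝ => ((l, 0) : ℝ × V)) 0 := analyticAt_id.prod analyticAt_const
    exact analyticAt_snd.comp (AnalyticAt.comp_of_eq hinv' h1 rfl)
  refine hcomp.congr ?_
  have hsrc : ∀ᶠ l in 𝓝 (0 : ℝ), (l, k l) ∈ Φ.source := by
    have h1 : Tendsto (fun l => (l, k l)) (𝓝 0) (𝓝 ((0, 0) : ℝ × V)) :=
      tendsto_id.prodMk_nhds hk
    exact h1.eventually (Φ.open_source.mem_nhds (hc.mem_toOpenPartialHomeomorph_source hd hn))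
  filter_upwards [hsrc, hfix] with l h1 h2
  have h3 : Φ (l, k l) = (l, 0) := by
    change Ψ (l, k l) = _
    simp only [Ψ, Prod.mk.injEq, true_and]
    rw [sub_eq_zero]; exact h2
  rw [← h3, Φ.left_inv h1]

/-- A solution of an ordinary differential equation with analytic right hand side is analytic.
The rescaled solutions `s ↦ u (l * s)`, `0 ≤ s ≤ 1`, solve a fixed point equation in `C([0, 1], E)`
with analytic dependence on `l`, and `u l` is their value at `s = 1`. -/
theorem analyticAt_of_hasDerivAt [CompleteSpace E] {X : E → E} {u : ℝ → E} {t₀ : ℝ}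
    (hX : AnalyticAt ℝ X (u t₀)) (hu : ∀ᶠ t in 𝓝 t₀, HasDerivAt u (X (u t)) t) :
    AnalyticAt ℝ u t₀ := by
  -- translate to `t₀ = 0`
  suffices H : AnalyticAt ℝ (fun l => u (t₀ + l)) 0 by
    have h1 : AnalyticAt ℝ (fun t : ℝ => t - t₀) t₀ := analyticAt_id.sub analyticAt_const
    have h2 := AnalyticAt.comp_of_eq H h1 (by simp)
    refine h2.congr (Eventually.of_forall fun t => ?_)
    simp
  set w : ℝ → E := fun l => u (t₀ + l) with hw
  have hw0 : w 0 = u t₀ := by simp [hw]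
  obtain ⟨S, hS, hSX⟩ := exists_analyticAt_superposition unitInterval hX
  have hXc : ∀ᶠ x in 𝓝 (u t₀), AnalyticAt ℝ X x := hX.eventually_analyticAt
  have hwd : ∀ᶠ l in 𝓝 (0 : ℝ), HasDerivAt w (X (w l)) l ∧ ContinuousAt (fun x => X (w x)) l := by
    have h1 : Tendsto (fun l : ℝ => t₀ + l) (𝓝 0) (𝓝 t₀) := by
      have : Continuous (fun l : ℝ => t₀ + l) := by fun_prop
      simpa using this.tendsto 0
    have h2 : ∀ᶠ l in 𝓝 (0 : ℝ), HasDerivAt w (X (w l)) l := by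
      filter_upwards [h1.eventually hu] with l hl
      exact hl.comp_const_add t₀ l
    have h3 : Tendsto w (𝓝 0) (𝓝 (u t₀)) := by
      rw [← hw0]
      exact h2.self_of_nhds.continuousAt
    filter_upwards [h2, h3.eventually hXc] with l hl hl'
    exact ⟨hl, ContinuousAt.comp hl'.continuousAt hl.continuousAt⟩
  obtain ⟨ε, hε, hball⟩ := Metric.eventually_nhds_iff_ball.1 hwd
  have hcont : ContinuousOn w (Metric.ball 0 ε) := fun l hl =>
    (hball l hl).1.continuousAt.continuousWithinAt
  have hmem : ∀ l ∈ Metric.ball (0 : ℝ) ε, ∀ s ∈ Icc (0 : ℝ) 1, l * s ∈ Metric.ball (0 : ℝ) ε := by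
    intro l hl s hs
    rw [mem_ball_zero_iff, norm_mul, Real.norm_of_nonneg hs.1] at *
    exact lt_of_le_of_lt (mul_le_of_le_one_right (norm_nonneg _) hs.2) hl
  -- the rescaled solution on the unit interval
  have hkc : ∀ l ∈ Metric.ball (0 : ℝ) ε,
      Continuous (fun s : unitInterval => w (l * s) - u t₀) := by
    intro l hl
    refine Continuous.sub ?_ continuous_const
    exact hcont.comp_continuous (by fun_prop) fun s => hmem l hl s s.2
  classical
  -- outside the ball the value of `k` is irrelevant
  let k : ℝ → C(unitInterval, E) := fun l =>
    if hl : l ∈ Metric.ball (0 : ℝ) ε then ⟨fun s => w (l * s) - u t₀, hkc l hl⟩ else 0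
  have hk : ∀ l ∈ Metric.ball (0 : ℝ) ε, ∀ s : unitInterval, k l s = w (l * s) - u t₀ := by
    intro l hl s
    simp only [k, dif_pos hl]
    rfl
  have hball0 : ∀ᶠ l in 𝓝 (0 : ℝ), l ∈ Metric.ball (0 : ℝ) ε := Metric.ball_mem_nhds 0 hε
  have hk0 : Tendsto k (𝓝 0) (𝓝 0) := by
    rw [Metric.tendsto_nhds]
    intro η hη
    have hwc : ContinuousAt w 0 := (hball 0 (Metric.mem_ball_self hε)).1.continuousAt
    obtain ⟨θ, hθ, hθ'⟩ := Metric.continuousAt_iff.1 hwc (η / 2) (half_pos hη)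
    filter_upwards [hball0, Metric.ball_mem_nhds (0 : ℝ) hθ] with l hl hl'
    rw [dist_zero_right]
    refine lt_of_le_of_lt ((ContinuousMap.norm_le _ (half_pos hη).le).2 fun s => ?_)
      (half_lt_self hη)
    rw [hk l hl, ← hw0, ← dist_eq_norm]
    refine (hθ' ?_).le
    rw [dist_zero_right, norm_mul, Real.norm_of_nonneg s.2.1]
    rw [mem_ball_zero_iff] at hl'
    exact lt_of_le_of_lt (mul_le_of_le_one_right (norm_nonneg _) s.2.2) hl'
  have hfix : ∀ᶠ l in 𝓝 (0 : ℝ), k l = l • primitive (S (k l)) := by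
    filter_upwards [hball0, hk0.eventually hSX] with l hl hSl
    ext s
    rw [ContinuousMap.smul_apply, primitive_apply, hk l hl, ← intervalIntegral.integral_smul]
    have hder : ∀ x ∈ uIcc (0 : ℝ) s, HasDerivAt (fun τ => w (l * τ)) (l • X (w (l * x))) x := by
      intro x hx
      rw [uIcc_of_le s.2.1] at hx
      have hx' : x ∈ Icc (0 : ℝ) 1 := ⟨hx.1, hx.2.trans s.2.2⟩
      have h1 := (hball _ (hmem l hl x hx')).1
      have h2 : HasDerivAt (fun τ : ℝ => l * τ) l x := by
        simpa using (hasDerivAt_id x).const_mul l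
      exact HasDerivAt.scomp (g₁ := fun y => w y) x h1 h2
    have hci : ContinuousOn (fun x => l • X (w (l * x))) (uIcc (0 : ℝ) s) := by
      intro x hx
      rw [uIcc_of_le s.2.1] at hx
      have hx' : x ∈ Icc (0 : ℝ) 1 := ⟨hx.1, hx.2.trans s.2.2⟩
      have h1 := (hball _ (hmem l hl x hx')).2
      have h2 : ContinuousAt (fun τ : ℝ => l * τ) x := by fun_prop
      exact ((ContinuousAt.comp (f := fun τ : ℝ => l * τ) h1 h2).const_smul l).continuousWithinAt
    have hint := intervalIntegral.integral_eq_sub_of_hasDerivAt hder hci.intervalIntegrable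
    rw [mul_zero, hw0] at hint
    rw [← hint]
    refine intervalIntegral.integral_congr fun x hx => ?_
    rw [uIcc_of_le s.2.1] at hx
    have hx' : x ∈ Icc (0 : ℝ) 1 := ⟨hx.1, hx.2.trans s.2.2⟩
    rw [IccExtend_of_mem _ _ hx', hSl, hk l hl]
    simp
  have hana : AnalyticAt ℝ k 0 := analyticAt_of_eventually_fixedPoint
    ((primitive (E := E)).analyticAt _ |>.comp hS) hk0 hfix
  have heval : AnalyticAt ℝ (fun l => u t₀ + k l 1) 0 :=
    analyticAt_const.add (AnalyticAt.comp (f := k)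
      (g := (ContinuousMap.evalCLM ℝ (1 : unitInterval) : C(unitInterval, E) →L[ℝ] E))
      (ContinuousLinearMap.analyticAt _ _) hana)
  refine heval.congr ?_
  filter_upwards [hball0] with l hl
  simp [hk l hl]

/-- If `u (·, s)` solves an equation with analytic right hand side `Z` for every `s` near `0`, then
the solution `u (·, 0)` together with its variation field `∂ₛ u (·, 0)` is analytic, because the
pair solves the linearised equation. -/
theorem analyticAt_variation [CompleteSpace E] {Z : E → E} {u : ℝ × ℝ → E} {t₀ : ℝ}
    (hu : ContDiffAt ℝ 2 u (t₀, 0)) (hZ : AnalyticAt ℝ Z (u (t₀, 0)))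
    (hode : ∀ᶠ x in 𝓝 ((t₀, 0) : ℝ × ℝ), fderiv ℝ u x (1, 0) = Z (u x)) :
    AnalyticAt ℝ (fun t => (u (t, 0), fderiv ℝ u (t, 0) (0, 1))) t₀ := by
  let Y : E × E → E × E := fun y => (Z y.1, fderiv ℝ Z y.1 y.2)
  have hY : AnalyticAt ℝ Y (u (t₀, 0), fderiv ℝ u (t₀, 0) (0, 1)) := by
    have h1 : AnalyticAt ℝ (fun y : E × E => Z y.1) (u (t₀, 0), fderiv ℝ u (t₀, 0) (0, 1)) :=
      AnalyticAt.comp_of_eq hZ analyticAt_fst rfl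
    have h2 : AnalyticAt ℝ (fun y : E × E => fderiv ℝ Z y.1)
        (u (t₀, 0), fderiv ℝ u (t₀, 0) (0, 1)) :=
      AnalyticAt.comp_of_eq hZ.fderiv analyticAt_fst rfl
    exact h1.prod (h2.contDiffAt.clm_apply (analyticAt_snd.contDiffAt (n := ω))).analyticAt
  refine analyticAt_of_hasDerivAt (X := Y) hY ?_
  have hline : Continuous (fun t : ℝ => ((t, 0) : ℝ × ℝ)) := by fun_prop
  have hu' : ∀ᶠ x in 𝓝 ((t₀, 0) : ℝ × ℝ), ContDiffAt ℝ 2 u x :=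
    hu.eventually (by simp)
  have hZ' : ∀ᶠ x in 𝓝 ((t₀, 0) : ℝ × ℝ), AnalyticAt ℝ Z (u x) :=
    hu.continuousAt.eventually hZ.eventually_analyticAt
  have hall := (hu'.and hZ').and (hode.eventually_nhds)
  filter_upwards [(hline.tendsto t₀).eventually hall] with t ht
  obtain ⟨⟨h1, h2⟩, h3⟩ := ht
  have hl : HasDerivAt (fun t : ℝ => ((t, 0) : ℝ × ℝ)) (1, 0) t :=
    (hasDerivAt_id t).prodMk (hasDerivAt_const t 0)
  have hud : DifferentiableAt ℝ u (t, 0) := h1.differentiableAt (by simp)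
  have hfd : DifferentiableAt ℝ (fderiv ℝ u) (t, 0) :=
    (h1.fderiv_right (m := 1) (by norm_num)).differentiableAt (by simp)
  have hd1 : HasDerivAt (fun t => u (t, 0)) (Z (u (t, 0))) t := by
    rw [← h3.self_of_nhds]
    exact hud.hasFDerivAt.comp_hasDerivAt t hl
  have hd2 : HasDerivAt (fun t => fderiv ℝ u (t, 0) (0, 1))
      (fderiv ℝ (fderiv ℝ u) (t, 0) (1, 0) (0, 1)) t := by
    have := hfd.hasFDerivAt.comp_hasDerivAt t hl
    simpa using this.clm_apply (hasDerivAt_const t ((0, 1) : ℝ × ℝ))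
  have hsymm : fderiv ℝ (fderiv ℝ u) (t, 0) (1, 0) (0, 1)
      = fderiv ℝ Z (u (t, 0)) (fderiv ℝ u (t, 0) (0, 1)) := by
    rw [(h1.isSymmSndFDerivAt (by simp)).eq]
    have e1 : fderiv ℝ (fun x => fderiv ℝ u x (1, 0)) (t, 0) = fderiv ℝ (Z ∘ u) (t, 0) :=
      Filter.EventuallyEq.fderiv_eq h3
    rw [fderiv_comp _ h2.differentiableAt hud] at e1
    have e2 := congrArg (fun A : ℝ × ℝ →L[ℝ] E => A (0, 1)) e1
    simp only [ContinuousLinearMap.comp_apply] at e2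
    rw [← e2, fderiv_clm_apply hfd (differentiableAt_const _)]
    simp
  rw [hsymm] at hd2
  exact hd1.prodMk hd2

end AnalyticODE

/-! ### Maps with a prescribed pulled back metric are determined by their 1-jet -/

namespace MetricRigidity

set_option maxSynthPendingDepth 3

open Set Filter ContinuousLinearMap

variable {E : Type*} [NormedAddCommGroup E] [NormedSpace ℝ E]

/-- The pullback of a bilinear form `b` by a linear map `L`. -/
def pullForm (b : E →L[ℝ] E →L[ℝ] ℝ) (L : E →L[ℝ] E) : E →L[ℝ] E →L[ℝ] ℝ :=
  ((compL ℝ E E ℝ).flip L) ∘L b ∘L L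

@[simp] lemma pullForm_apply (b : E →L[ℝ] E →L[ℝ] ℝ) (L : E →L[ℝ] E) (u w : E) :
    pullForm b L u w = b (L u) (L w) := rfl

/-- The pullback of a trilinear form `τ` by a linear map `L`. -/
def pullTri (τ : E →L[ℝ] E →L[ℝ] E →L[ℝ] ℝ) (L : E →L[ℝ] E) : E →L[ℝ] E →L[ℝ] E →L[ℝ] ℝ :=
  (compL ℝ E (E →L[ℝ] ℝ) (E →L[ℝ] ℝ) ((compL ℝ E E ℝ).flip L)) ∘L
    ((compL ℝ E E (E →L[ℝ] ℝ)).flip L) ∘L τ ∘L L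

@[simp] lemma pullTri_apply (τ : E →L[ℝ] E →L[ℝ] E →L[ℝ] ℝ) (L : E →L[ℝ] E) (v u w : E) :
    pullTri τ L v u w = τ (L v) (L u) (L w) := rfl

/-- The combination `½ (K(v; u, w) + K(u; v, w) - K(w; v, u))` of the Koszul formula. -/
def koszul (K : E →L[ℝ] E →L[ℝ] E →L[ℝ] ℝ) (v : E) : E →L[ℝ] E →L[ℝ] ℝ :=
  (1 / 2 : ℝ) • (K v + K.flip v - (K.flip v).flip)

lemma koszul_apply (K : E →L[ℝ] E →L[ℝ] E →L[ℝ] ℝ) (v u w : E) :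
    koszul K v u w = (1 / 2) * (K v u w + K u v w - K w v u) := rfl

/-- The second derivative of a map `F` is determined by its first derivative, the target metric `H`
and the pulled back metric `G`: this is the Koszul formula. -/
lemma metric_apply_second_fderiv {F : E → E} {H G : E → E →L[ℝ] E →L[ℝ] ℝ} {y : E}
    (hF : ContDiffAt ℝ 2 F y) (hH : DifferentiableAt ℝ H (F y))
    (hsymm : ∀ a b, H (F y) a b = H (F y) b a)
    (hG : G =ᶠ[𝓝 y] fun z => pullForm (H (F z)) (fderiv ℝ F z)) (v u w : E) :
    H (F y) (fderiv ℝ (fderiv ℝ F) y v u) (fderiv ℝ F y w)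
      = koszul (fderiv ℝ G y - pullTri (fderiv ℝ H (F y)) (fderiv ℝ F y)) v u w := by
  have hFd : HasFDerivAt F (fderiv ℝ F y) y := (hF.differentiableAt (by simp)).hasFDerivAt
  have hFd2 : HasFDerivAt (fderiv ℝ F) (fderiv ℝ (fderiv ℝ F) y) y :=
    ((hF.fderiv_right (m := 1) (by norm_num)).differentiableAt (by simp)).hasFDerivAt
  have hHF : HasFDerivAt (fun z => H (F z)) (fderiv ℝ H (F y) ∘L fderiv ℝ F y) y :=
    hH.hasFDerivAt.comp y hFd
  have hs := hF.isSymmSndFDerivAt (by simp)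
  have hGd : DifferentiableAt ℝ G y := by
    refine DifferentiableAt.congr_of_eventuallyEq ?_ hG
    unfold pullForm
    refine DifferentiableAt.clm_comp ?_ (hHF.differentiableAt.clm_comp hFd2.differentiableAt)
    exact ((compL ℝ E E ℝ).flip.differentiableAt).comp y hFd2.differentiableAt
  have key : ∀ v u w : E, fderiv ℝ G y v u w
      = fderiv ℝ H (F y) (fderiv ℝ F y v) (fderiv ℝ F y u) (fderiv ℝ F y w)
        + H (F y) (fderiv ℝ (fderiv ℝ F) y v u) (fderiv ℝ F y w)
        + H (F y) (fderiv ℝ (fderiv ℝ F) y v w) (fderiv ℝ F y u) := by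
    intro v u w
    have h1 : HasFDerivAt (fun z => G z u w) _ y :=
      (hGd.hasFDerivAt.clm_apply (hasFDerivAt_const u y)).clm_apply (hasFDerivAt_const w y)
    have h2 : HasFDerivAt (fun z => H (F z) (fderiv ℝ F z u) (fderiv ℝ F z w)) _ y :=
      (hHF.clm_apply (hFd2.clm_apply (hasFDerivAt_const u y))).clm_apply
        (hFd2.clm_apply (hasFDerivAt_const w y))
    have h3 : (fun z => G z u w) =ᶠ[𝓝 y] fun z => H (F z) (fderiv ℝ F z u) (fderiv ℝ F z w) := by
      filter_upwards [hG] with z hz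
      rw [hz, pullForm_apply]
    have h4 := congrArg (fun A : E →L[ℝ] ℝ => A v) (h1.unique (h2.congr_of_eventuallyEq h3))
    simp at h4
    rw [h4, hsymm (fderiv ℝ F y u)]
    ring
  rw [koszul_apply]
  simp only [_root_.sub_apply, pullTri_apply, key]
  rw [hs.eq u v, hs.eq w v, hs.eq w u]
  ring

lemma contDiffAt_flip {V A B : Type*} [NormedAddCommGroup V] [NormedSpace ℝ V]
    [NormedAddCommGroup A] [NormedSpace ℝ A] [NormedAddCommGroup B] [NormedSpace ℝ B]
    {n : WithTop ℕ∞} {f : V → E →L[ℝ] A →L[ℝ] B} {q : V} (hf : ContDiffAt ℝ n f q) :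
    ContDiffAt ℝ n (fun q => (f q).flip) q :=
  ((flipₗᵢ ℝ E A B).contDiff.contDiffAt).comp q hf

variable [FiniteDimensional ℝ E]

/-- The right hand side of the differential equation along straight lines `y + t v` satisfied by
the 1-jet `(F, DF)` of a map with `F^* H = G`, as an autonomous system for `(v, y, F, DF)`. The
second derivative is recovered from the Koszul formula by inverting `a ↦ H(F)(a, DF ·)`; the value
of `inverse` at a non-invertible map plays no role, since the field is only used where `H` is
nondegenerate and `DF` is injective. -/
def jetField (H G : E → E →L[ℝ] E →L[ℝ] ℝ) (q : E × E × E × (E →L[ℝ] E)) :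
    E × E × E × (E →L[ℝ] E) :=
  (0, q.1, q.2.2.2 q.1,
    ContinuousLinearMap.inverse (((compL ℝ E E ℝ).flip q.2.2.2) ∘L H q.2.2.1) ∘L
      koszul (fderiv ℝ G q.2.1 - pullTri (fderiv ℝ H q.2.2.1) q.2.2.2) q.1)

/-- For a nondegenerate form `b` and an injective `L`, the map `a ↦ b (a, L ·)` is an isomorphism
onto the dual space. -/
lemma exists_equiv_lower {b : E →L[ℝ] E →L[ℝ] ℝ} {L : E →L[ℝ] E}
    (hnd : ∀ a, (∀ c, b a c = 0) → a = 0) (hL : Function.Injective L) :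
    ∃ e : E ≃L[ℝ] (E →L[ℝ] ℝ), (e : E →L[ℝ] E →L[ℝ] ℝ) = ((compL ℝ E E ℝ).flip L) ∘L b := by
  have hinj : Function.Injective (((compL ℝ E E ℝ).flip L) ∘L b) := by
    rw [injective_iff_map_eq_zero]
    intro a ha
    refine hnd a fun c => ?_
    obtain ⟨c, rfl⟩ := (LinearMap.injective_iff_surjective (f := (L : E →ₗ[ℝ] E))).1 hL c
    exact congrArg (fun A : E →L[ℝ] ℝ => A c) ha
  have hdim : Module.finrank ℝ E = Module.finrank ℝ (E →L[ℝ] ℝ) := by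
    rw [← (LinearMap.toContinuousLinearMap (𝕜 := ℝ) (E := E) (F' := ℝ)).finrank_eq]
    exact (Subspace.dual_finrank_eq (K := ℝ) (V := E)).symm
  refine ⟨(LinearEquiv.ofInjectiveOfFinrankEq
    ((((compL ℝ E E ℝ).flip L) ∘L b : E →L[ℝ] E →L[ℝ] ℝ) : E →ₗ[ℝ] E →L[ℝ] ℝ)
      hinj hdim).toContinuousLinearEquiv, ?_⟩
  ext a c
  rfl

lemma contDiffAt_jetField {H G : E → E →L[ℝ] E →L[ℝ] ℝ} {q : E × E × E × (E →L[ℝ] E)}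
    (hH : ContDiffAt ℝ 2 H q.2.2.1) (hG : ContDiffAt ℝ 2 G q.2.1)
    (hnd : ∀ a, (∀ c, H q.2.2.1 a c = 0) → a = 0) (hL : Function.Injective q.2.2.2) :
    ContDiffAt ℝ 1 (jetField H G) q := by
  obtain ⟨e, he⟩ := exists_equiv_lower hnd hL
  have c1 : ContDiffAt ℝ 1 (fun q : E × E × E × (E →L[ℝ] E) => q.1) q := by fun_prop
  have c2 : ContDiffAt ℝ 1 (fun q : E × E × E × (E →L[ℝ] E) => q.2.1) q := by fun_prop
  have c3 : ContDiffAt ℝ 1 (fun q : E × E × E × (E →L[ℝ] E) => q.2.2.1) q := by fun_prop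
  have c4 : ContDiffAt ℝ 1 (fun q : E × E × E × (E →L[ℝ] E) => q.2.2.2) q := by fun_prop
  have c5 : ContDiffAt ℝ 1 (fun q : E × E × E × (E →L[ℝ] E) => H q.2.2.1) q :=
    ContDiffAt.comp q (g := H) (hH.of_le (by norm_num)) c3
  have c6 : ContDiffAt ℝ 1 (fun q : E × E × E × (E →L[ℝ] E) => fderiv ℝ H q.2.2.1) q :=
    ContDiffAt.comp q (g := fderiv ℝ H) (hH.fderiv_right (by norm_num)) c3
  have c7 : ContDiffAt ℝ 1 (fun q : E × E × E × (E →L[ℝ] E) => fderiv ℝ G q.2.1) q :=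
    ContDiffAt.comp q (g := fderiv ℝ G) (hG.fderiv_right (by norm_num)) c2
  have c8 : ContDiffAt ℝ 1
      (fun q : E × E × E × (E →L[ℝ] E) => (compL ℝ E E ℝ).flip q.2.2.2) q :=
    ((compL ℝ E E ℝ).flip.contDiff.contDiffAt).comp q c4
  have c9 : ContDiffAt ℝ 1 (fun q : E × E × E × (E →L[ℝ] E) =>
      ContinuousLinearMap.inverse (((compL ℝ E E ℝ).flip q.2.2.2) ∘L H q.2.2.1)) q := by
    refine ContDiffAt.comp q (g := ContinuousLinearMap.inverse) ?_ (c8.clm_comp c5)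
    rw [← he]
    exact contDiffAt_map_inverse e
  have c10 : ContDiffAt ℝ 1 (fun q : E × E × E × (E →L[ℝ] E) =>
      fderiv ℝ G q.2.1 - pullTri (fderiv ℝ H q.2.2.1) q.2.2.2) q := by
    refine c7.sub ?_
    unfold pullTri
    refine ContDiffAt.clm_comp ?_ (ContDiffAt.clm_comp ?_ (c6.clm_comp c4))
    · exact ((compL ℝ E (E →L[ℝ] ℝ) (E →L[ℝ] ℝ)).contDiff.contDiffAt).comp q c8
    · exact ((compL ℝ E E (E →L[ℝ] ℝ)).flip.contDiff.contDiffAt).comp q c4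
  refine contDiffAt_const.prodMk (c1.prodMk ((c4.clm_apply c1).prodMk (c9.clm_comp ?_)))
  unfold koszul
  refine ContDiffAt.const_smul _ (ContDiffAt.sub (ContDiffAt.add ?_ ?_) ?_)
  · exact c10.clm_apply c1
  · exact (contDiffAt_flip c10).clm_apply c1
  · exact contDiffAt_flip ((contDiffAt_flip c10).clm_apply c1)

/-- Two maps which pull back a nondegenerate metric `H` to the same metric and have the same 1-jet
at `x` coincide near `x`: their 1-jets solve the same ordinary differential equation along the
segments issued from `x`. -/
theorem eventuallyEq_of_pullForm_eq {F₁ F₂ : E → E} {H : E → E →L[ℝ] E →L[ℝ] ℝ} {x : E}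
    (h₁ : ContDiffAt ℝ 3 F₁ x) (h₂ : ContDiffAt ℝ 3 F₂ x) (hH : ContDiffAt ℝ 2 H (F₁ x))
    (hsymm : ∀ᶠ z in 𝓝 (F₁ x), ∀ a b, H z a b = H z b a)
    (hnd : ∀ a, (∀ b, H (F₁ x) a b = 0) → a = 0)
    (hinj : Function.Injective (fderiv ℝ F₁ x))
    (hpull : ∀ᶠ y in 𝓝 x, ∀ a b, H (F₁ y) (fderiv ℝ F₁ y a) (fderiv ℝ F₁ y b)
      = H (F₂ y) (fderiv ℝ F₂ y a) (fderiv ℝ F₂ y b))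
    (h0 : F₁ x = F₂ x) (hd : fderiv ℝ F₁ x = fderiv ℝ F₂ x) : F₁ =ᶠ[𝓝 x] F₂ := by
  let G : E → E →L[ℝ] E →L[ℝ] ℝ := fun z => pullForm (H (F₁ z)) (fderiv ℝ F₁ z)
  have hG : ContDiffAt ℝ 2 G x := by
    have a1 : ContDiffAt ℝ 2 (fderiv ℝ F₁) x := h₁.fderiv_right (by norm_num)
    have a2 : ContDiffAt ℝ 2 (fun z => H (F₁ z)) x :=
      hH.comp x (h₁.of_le (by norm_num))
    refine ContDiffAt.clm_comp ?_ (a2.clm_comp a1)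
    exact ((compL ℝ E E ℝ).flip.contDiff.contDiffAt).comp x a1
  -- the 1-jets of both maps solve the same equation along segments issued from `x`
  have jet : ∀ F : E → E, ContDiffAt ℝ 3 F x → F x = F₁ x → fderiv ℝ F x = fderiv ℝ F₁ x →
      (∀ᶠ y in 𝓝 x, ∀ a b, H (F₁ y) (fderiv ℝ F₁ y a) (fderiv ℝ F₁ y b)
        = H (F y) (fderiv ℝ F y a) (fderiv ℝ F y b)) →
      ∀ᶠ y in 𝓝 x, ContDiffAt ℝ 3 F y ∧ ∀ v : E, jetField H G (v, y, F y, fderiv ℝ F y)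
        = (0, v, fderiv ℝ F y v, fderiv ℝ (fderiv ℝ F) y v) := by
    intro F hF hFx hFdx hFp
    have b1 : ∀ᶠ y in 𝓝 x, ContDiffAt ℝ 3 F y := hF.eventually (by simp)
    have b2 : ∀ᶠ y in 𝓝 x, DifferentiableAt ℝ H (F y) ∧ ∀ a b, H (F y) a b = H (F y) b a := by
      have t : Tendsto F (𝓝 x) (𝓝 (F₁ x)) := hFx ▸ hF.continuousAt
      have hHe : ∀ᶠ z in 𝓝 (F₁ x), ContDiffAt ℝ 2 H z := hH.eventually (by simp)
      filter_upwards [t.eventually hHe, t.eventually hsymm] with y hy hy'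
      exact ⟨hy.differentiableAt (by simp), hy'⟩
    -- invertibility is an open condition
    have b3 : ∀ᶠ y in 𝓝 x, ∃ e : E ≃L[ℝ] (E →L[ℝ] ℝ),
        (e : E →L[ℝ] E →L[ℝ] ℝ) = ((compL ℝ E E ℝ).flip (fderiv ℝ F y)) ∘L H (F y) := by
      obtain ⟨e, he⟩ := exists_equiv_lower hnd hinj
      have hc : ContinuousAt
          (fun y => ((compL ℝ E E ℝ).flip (fderiv ℝ F y)) ∘L H (F y)) x := by
        have a1 : ContinuousAt (fderiv ℝ F) x :=
          (hF.fderiv_right (m := 2) (by norm_num)).continuousAt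
        have a2 : ContinuousAt (fun z => H (F z)) x :=
          ContinuousAt.comp (by rw [hFx]; exact hH.continuousAt) hF.continuousAt
        have a3 : ContinuousAt (fun y => (compL ℝ E E ℝ).flip (fderiv ℝ F y)) x :=
          ((compL ℝ E E ℝ).flip.continuous.continuousAt).comp a1
        exact a3.clm_comp a2
      have hn := ContinuousLinearEquiv.nhds e
      rw [he, ← hFx, ← hFdx] at hn
      filter_upwards [hc hn] with y hy
      exact hy
    filter_upwards [b1, b2, b3, hFp.eventually_nhds] with y y1 y2 y3 y4
    refine ⟨y1, fun v => ?_⟩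
    obtain ⟨e, he⟩ := y3
    simp only [jetField, Prod.mk.injEq, true_and]
    ext1 u
    rw [← he, ContinuousLinearMap.inverse_equiv, ContinuousLinearMap.comp_apply]
    rw [ContinuousLinearEquiv.coe_coe, ContinuousLinearEquiv.symm_apply_eq]
    have he' : ∀ a, e a = (((compL ℝ E E ℝ).flip (fderiv ℝ F y)) ∘L H (F y)) a := fun a => by
      rw [← he]; rfl
    rw [he']
    ext1 w
    refine (metric_apply_second_fderiv (G := G) (y1.of_le (by norm_num)) y2.1 y2.2 ?_ v u w).symm
    filter_upwards [y4] with z hz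
    ext a b
    exact hz a b
  obtain ⟨K, s, hs, hlip⟩ :=
    (contDiffAt_jetField (q := ((0 : E), x, F₁ x, fderiv ℝ F₁ x)) hH hG hnd
      hinj).exists_lipschitzOnWith
  have j₁ := jet F₁ h₁ rfl rfl (Eventually.of_forall fun _ _ _ => rfl)
  have j₂ := jet F₂ h₂ h0.symm hd.symm hpull
  have near : ∀ F : E → E, ContDiffAt ℝ 3 F x → F x = F₁ x → fderiv ℝ F x = fderiv ℝ F₁ x →
      ∀ᶠ q in 𝓝 ((0, x) : E × E), ((q.1, q.2, F q.2, fderiv ℝ F q.2) : E × E × E × _) ∈ s := by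
    intro F hF hFx hFdx
    have hc : ContinuousAt
        (fun q : E × E => ((q.1, q.2, F q.2, fderiv ℝ F q.2) : E × E × E × (E →L[ℝ] E)))
        (0, x) := by
      have a1 : ContinuousAt (fderiv ℝ F) x :=
        (hF.fderiv_right (m := 2) (by norm_num)).continuousAt
      exact continuousAt_fst.prodMk (continuousAt_snd.prodMk
        ((ContinuousAt.comp (f := fun q : E × E => q.2) hF.continuousAt
          continuousAt_snd).prodMk (ContinuousAt.comp (f := fun q : E × E => q.2) a1
          continuousAt_snd)))
    refine hc.eventually_mem ?_
    simpa only [hFx, hFdx] using hs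
  have hall := ((near F₁ h₁ rfl rfl).and (near F₂ h₂ h0.symm hd.symm)).and
    ((continuousAt_snd (p := ((0, x) : E × E))).eventually (j₁.and j₂))
  obtain ⟨ε, hε, hb⟩ := Metric.eventually_nhds_iff_ball.1 hall
  filter_upwards [Metric.ball_mem_nhds x hε] with y hy
  set v := y - x with hv
  have hvε : ‖v‖ < ε := by rwa [hv, ← dist_eq_norm]
  have hmem : ∀ t ∈ Icc (0 : ℝ) 1, ((v, x + t • v) : E × E) ∈ Metric.ball ((0, x) : E × E) ε := by
    intro t ht
    rw [Metric.mem_ball, Prod.dist_eq, max_lt_iff]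
    refine ⟨by simpa using hvε, ?_⟩
    simp only [dist_self_add_left, norm_smul, Real.norm_of_nonneg ht.1]
    exact lt_of_le_of_lt (mul_le_of_le_one_left (norm_nonneg _) ht.2) hvε
  have sol : ∀ F : E → E, (∀ t ∈ Icc (0 : ℝ) 1, ContDiffAt ℝ 3 F (x + t • v) ∧
      ∀ v' : E, jetField H G (v', x + t • v, F (x + t • v), fderiv ℝ F (x + t • v))
        = (0, v', fderiv ℝ F (x + t • v) v', fderiv ℝ (fderiv ℝ F) (x + t • v) v')) →
      ∀ t ∈ Icc (0 : ℝ) 1, HasDerivAt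
        (fun t : ℝ => ((v, x + t • v, F (x + t • v), fderiv ℝ F (x + t • v)) :
          E × E × E × (E →L[ℝ] E)))
        (jetField H G (v, x + t • v, F (x + t • v), fderiv ℝ F (x + t • v))) t := by
    intro F hF t ht
    obtain ⟨f1, f2⟩ := hF t ht
    rw [f2 v]
    have hl : HasDerivAt (fun t : ℝ => x + t • v) v t := by
      simpa using ((hasDerivAt_id t).smul_const v).const_add x
    refine (hasDerivAt_const t v).prodMk (hl.prodMk (HasDerivAt.prodMk ?_ ?_))
    · exact (f1.differentiableAt (by simp)).hasFDerivAt.comp_hasDerivAt t hl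
    · exact ((f1.fderiv_right (m := 2) (by norm_num)).differentiableAt
        (by simp)).hasFDerivAt.comp_hasDerivAt t hl
  have sol₁ := sol F₁ fun t ht => (hb _ (hmem t ht)).2.1
  have sol₂ := sol F₂ fun t ht => (hb _ (hmem t ht)).2.2
  have huniq := ODE_solution_unique_of_mem_Icc_right (v := fun _ => jetField H G)
    (s := fun _ => s) (K := K) (a := 0) (b := 1)
    (fun _ _ => hlip)
    (fun t ht => (sol₁ t ht).continuousAt.continuousWithinAt)
    (fun t ht => (sol₁ t (Ico_subset_Icc_self ht)).hasDerivWithinAt)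
    (fun t ht => (hb _ (hmem t (Ico_subset_Icc_self ht))).1.1)
    (fun t ht => (sol₂ t ht).continuousAt.continuousWithinAt)
    (fun t ht => (sol₂ t (Ico_subset_Icc_self ht)).hasDerivWithinAt)
    (fun t ht => (hb _ (hmem t (Ico_subset_Icc_self ht))).1.2)
    (by simp [h0, hd])
  have := congrArg (fun q : E × E × E × (E →L[ℝ] E) => q.2.2.1) (huniq ⟨zero_le_one, le_rfl⟩)
  simpa [hv] using this

end MetricRigidity

/-! ### The pullback of a Riemannian metric -/

namespace RiemGeom
open Set Filter

section Chart

variable {d : ℕ} {M : Type*} [MetricSpace M] [ChartedSpace (EuclideanSpace ℝ (Fin d)) M]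
  [IsManifold (𝓡 d) ω M]

lemma injective_mfderiv_extChartAt_symm {x₀ : M} {y : EuclideanSpace ℝ (Fin d)}
    (hy : y ∈ (extChartAt (𝓡 d) x₀).target) :
    Function.Injective (mfderiv (𝓡 d) (𝓡 d) (extChartAt (𝓡 d) x₀).symm y) := by
  have : IsManifold (𝓡 d) 1 M := IsManifold.of_le (n := ω) le_top
  have h := isInvertible_mfderivWithin_extChartAt_symm (I := 𝓡 d) hy
  rw [ModelWithCorners.Boundaryless.range_eq_univ, mfderivWithin_univ] at h
  obtain ⟨e, he⟩ := h
  rw [← he]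
  exact e.injective

lemma contMDiffAt_extChartAt_symm {x₀ : M} {y : EuclideanSpace ℝ (Fin d)}
    (hy : y ∈ (extChartAt (𝓡 d) x₀).target) :
    ContMDiffAt (𝓡 d) (𝓡 d) ω (extChartAt (𝓡 d) x₀).symm y :=
  (contMDiffOn_extChartAt_symm x₀).contMDiffAt ((isOpen_extChartAt_target x₀).mem_nhds hy)

lemma contMDiffAt_extChartAt_of_mem {x₀ p : M} (hp : p ∈ (extChartAt (𝓡 d) x₀).source) :
    ContMDiffAt (𝓡 d) (𝓡 d) ω (extChartAt (𝓡 d) x₀) p :=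
  contMDiffAt_extChartAt' (by rwa [extChartAt_source] at hp)

end Chart

section Metric

variable {d : ℕ} {M : Type*} [MetricSpace M] [ChartedSpace (EuclideanSpace ℝ (Fin d)) M]
  [RiemannianBundle (fun x : M => TangentSpace (𝓡 d) x)]

/-- The pullback of the Riemannian metric under `ψ`, as a bilinear form on `ℝᵈ`. -/
def pullbackForm (ψ : EuclideanSpace ℝ (Fin d) → M) (y : EuclideanSpace ℝ (Fin d)) :
    EuclideanSpace ℝ (Fin d) →L[ℝ] EuclideanSpace ℝ (Fin d) →L[ℝ] ℝ :=
  (innerSL ℝ (E := TangentSpace (𝓡 d) (ψ y))).bilinearComp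
    (mfderiv (𝓡 d) (𝓡 d) ψ y) (mfderiv (𝓡 d) (𝓡 d) ψ y)

lemma pullbackForm_apply (ψ : EuclideanSpace ℝ (Fin d) → M) (y u w : EuclideanSpace ℝ (Fin d)) :
    pullbackForm ψ y u w = inner ℝ (mfderiv (𝓡 d) (𝓡 d) ψ y u : TangentSpace (𝓡 d) (ψ y))
      (mfderiv (𝓡 d) (𝓡 d) ψ y w : TangentSpace (𝓡 d) (ψ y)) := rfl

lemma pullbackForm_comm (ψ : EuclideanSpace ℝ (Fin d) → M) (y u w : EuclideanSpace ℝ (Fin d)) :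
    pullbackForm ψ y u w = pullbackForm ψ y w u := by
  rw [pullbackForm_apply, pullbackForm_apply]
  exact real_inner_comm _ _

lemma eq_zero_of_pullbackForm_self {ψ : EuclideanSpace ℝ (Fin d) → M}
    {y u : EuclideanSpace ℝ (Fin d)} (hψ : Function.Injective (mfderiv (𝓡 d) (𝓡 d) ψ y))
    (h : pullbackForm ψ y u u = 0) : u = 0 := by
  rw [pullbackForm_apply, inner_self_eq_zero] at h
  exact hψ (h.trans (map_zero (mfderiv (𝓡 d) (𝓡 d) ψ y)).symm)

lemma pullbackForm_comp {ψ : EuclideanSpace ℝ (Fin d) → M}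
    {F : EuclideanSpace ℝ (Fin d) → EuclideanSpace ℝ (Fin d)} {y : EuclideanSpace ℝ (Fin d)}
    (hψ : MDifferentiableAt (𝓡 d) (𝓡 d) ψ (F y)) (hF : DifferentiableAt ℝ F y)
    (u w : EuclideanSpace ℝ (Fin d)) :
    pullbackForm (ψ ∘ F) y u w = pullbackForm ψ (F y) (fderiv ℝ F y u) (fderiv ℝ F y w) := by
  rw [pullbackForm_apply, pullbackForm_apply, mfderiv_comp y hψ hF.mdifferentiableAt,
    mfderiv_eq_fderiv]
  rfl

lemma pullbackForm_congr {ψ ψ' : EuclideanSpace ℝ (Fin d) → M} {y : EuclideanSpace ℝ (Fin d)}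
    (h : ψ =ᶠ[𝓝 y] ψ') : pullbackForm ψ y = pullbackForm ψ' y := by
  have h1 := h.mfderiv_eq (I := 𝓡 d) (I' := 𝓡 d)
  unfold pullbackForm
  rw [h1]
  -- the tangent spaces at `ψ y` and `ψ' y` are the same type; only the inner product involves the
  -- base point
  let A : EuclideanSpace ℝ (Fin d) →L[ℝ] EuclideanSpace ℝ (Fin d) := mfderiv (𝓡 d) (𝓡 d) ψ' y
  have key : ∀ p q : M, p = q →
      (innerSL ℝ (E := TangentSpace (𝓡 d) p)).bilinearComp
        (show EuclideanSpace ℝ (Fin d) →L[ℝ] TangentSpace (𝓡 d) p from A)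
        (show EuclideanSpace ℝ (Fin d) →L[ℝ] TangentSpace (𝓡 d) p from A)
      = (innerSL ℝ (E := TangentSpace (𝓡 d) q)).bilinearComp
        (show EuclideanSpace ℝ (Fin d) →L[ℝ] TangentSpace (𝓡 d) q from A)
        (show EuclideanSpace ℝ (Fin d) →L[ℝ] TangentSpace (𝓡 d) q from A) := by
    rintro p q rfl
    rfl
  exact key _ _ h.self_of_nhds

lemma pullbackMetric_eq (ψ : EuclideanSpace ℝ (Fin d) → M) (y : EuclideanSpace ℝ (Fin d))
    (i j : Fin d) : pullbackMetric ψ y i j =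
      pullbackForm ψ y (EuclideanSpace.single i 1) (EuclideanSpace.single j 1) := rfl

lemma pullbackForm_eq_sum (ψ : EuclideanSpace ℝ (Fin d) → M) (y u w : EuclideanSpace ℝ (Fin d)) :
    pullbackForm ψ y u w = ∑ i, ∑ j, u i * (w j * pullbackMetric ψ y i j) := by
  have hb := fun v : EuclideanSpace ℝ (Fin d) =>
    (EuclideanSpace.basisFun (Fin d) ℝ).sum_repr v
  simp only [EuclideanSpace.basisFun_apply, EuclideanSpace.basisFun_repr] at hb
  conv_lhs => rw [← hb u, ← hb w]
  simp only [map_sum, map_smul, _root_.sum_apply, _root_.smul_apply,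
    smul_eq_mul, pullbackMetric_eq, Finset.mul_sum]
  rw [Finset.sum_comm]
  refine Finset.sum_congr rfl fun i _ => Finset.sum_congr rfl fun j _ => by ring

lemma det_pullbackMetric_ne_zero {ψ : EuclideanSpace ℝ (Fin d) → M} {y : EuclideanSpace ℝ (Fin d)}
    (hψ : Function.Injective (mfderiv (𝓡 d) (𝓡 d) ψ y)) :
    (Matrix.of (pullbackMetric ψ y)).det ≠ 0 := by
  intro h0
  obtain ⟨v, hv, hv0⟩ := Matrix.exists_mulVec_eq_zero_iff.2 h0
  refine hv ?_
  have : (WithLp.toLp 2 v : EuclideanSpace ℝ (Fin d)) = 0 := by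
    refine eq_zero_of_pullbackForm_self hψ ?_
    rw [pullbackForm_eq_sum]
    refine Finset.sum_eq_zero fun i _ => ?_
    rw [← Finset.mul_sum]
    have := congrFun hv0 i
    simp only [Matrix.mulVec, dotProduct, Matrix.of_apply, Pi.zero_apply] at this
    simp only [mul_comm (v _)]
    rw [this, zero_mul]
  simpa using this

variable [IsManifold (𝓡 d) ω M]

variable [IsContMDiffRiemannianBundle (𝓡 d) ω (EuclideanSpace ℝ (Fin d))
      (fun x : M => TangentSpace (𝓡 d) x)]

lemma contDiffOn_pullbackForm {ψ : EuclideanSpace ℝ (Fin d) → M}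
    {U : Set (EuclideanSpace ℝ (Fin d))} (hU : IsOpen U) {n m : WithTop ℕ∞}
    (hψ : ContMDiffOn (𝓡 d) (𝓡 d) m ψ U) (hnm : n + 1 ≤ m) :
    ContDiffOn ℝ n (pullbackForm ψ) U := by
  have : IsManifold (𝓡 d) 1 M := IsManifold.of_le (n := ω) le_top
  -- the image of a constant vector field is smooth as a map into the tangent bundle
  have key : ∀ u : EuclideanSpace ℝ (Fin d), ContMDiffOn (𝓡 d) (𝓡 d).tangent n
      (fun y => (⟨ψ y, mfderiv (𝓡 d) (𝓡 d) ψ y u⟩ : TangentBundle (𝓡 d) M)) U := by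
    intro u
    have h1 := hψ.contMDiffOn_tangentMapWithin hnm hU.uniqueMDiffOn
    have h2 : ContMDiffOn (𝓡 d) (𝓡 d).tangent n
        (fun y => (⟨y, u⟩ : TangentBundle (𝓡 d) (EuclideanSpace ℝ (Fin d)))) U :=
      (contMDiffOn_vectorSpace_iff_contDiffOn
        (V := fun _ : EuclideanSpace ℝ (Fin d) => u)).2 contDiffOn_const
    refine (h1.comp h2 fun y hy => hy).congr fun y hy => ?_
    simp only [Function.comp_apply, tangentMapWithin]
    rw [mfderivWithin_of_isOpen hU hy]
  rw [contDiffOn_clm_apply]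
  intro u
  rw [contDiffOn_clm_apply]
  intro w
  rw [← contMDiffOn_iff_contDiffOn]
  exact ContMDiffOn.inner_bundle (key u) (key w)

lemma contDiffAt_pullbackForm_extChartAt_symm {x₀ : M} {y : EuclideanSpace ℝ (Fin d)}
    (hy : y ∈ (extChartAt (𝓡 d) x₀).target) :
    ContDiffAt ℝ ω (pullbackForm (extChartAt (𝓡 d) x₀).symm) y :=
  (contDiffOn_pullbackForm (n := ω) (m := ω) (isOpen_extChartAt_target x₀)
    (contMDiffOn_extChartAt_symm x₀) le_top).contDiffAt
    ((isOpen_extChartAt_target x₀).mem_nhds hy)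

lemma contDiffAt_pullbackMetric_extChartAt_symm {x₀ : M} {y : EuclideanSpace ℝ (Fin d)}
    (hy : y ∈ (extChartAt (𝓡 d) x₀).target) (i j : Fin d) :
    ContDiffAt ℝ ω (fun z => pullbackMetric (extChartAt (𝓡 d) x₀).symm z i j) y :=
  ((contDiffAt_pullbackForm_extChartAt_symm hy).clm_apply contDiffAt_const).clm_apply
    contDiffAt_const

/-- The Christoffel symbols in a chart of a real analytic Riemannian manifold are analytic. -/
lemma contDiffAt_christoffel {x₀ : M} {y : EuclideanSpace ℝ (Fin d)}
    (hy : y ∈ (extChartAt (𝓡 d) x₀).target) (k i j : Fin d) :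
    ContDiffAt ℝ ω (christoffel (pullbackMetric (extChartAt (𝓡 d) x₀).symm) k i j) y := by
  have hG := contDiffAt_pullbackMetric_extChartAt_symm hy
  have hp : ∀ a b c, ContDiffAt ℝ ω (fun z => partialDeriv a
      (fun z => pullbackMetric (extChartAt (𝓡 d) x₀).symm z b c) z) y := fun a b c =>
    ((hG b c).fderiv_right (m := ω) le_top).clm_apply contDiffAt_const
  -- Cramer's rule: determinants and inverses are rational functions of the entries
  have hdet : ∀ A : EuclideanSpace ℝ (Fin d) → Matrix (Fin d) (Fin d) ℝ,
      (∀ a b, ContDiffAt ℝ ω (fun z => A z a b) y) → ContDiffAt ℝ ω (fun z => (A z).det) y := by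
    intro A hA
    simp only [Matrix.det_apply']
    exact ContDiffAt.sum fun σ _ => contDiffAt_const.mul (contDiffAt_prod fun l _ => hA _ _)
  have hinv : ∀ l, ContDiffAt ℝ ω
      (fun z => (Matrix.of (pullbackMetric (extChartAt (𝓡 d) x₀).symm z))⁻¹ k l) y := by
    intro l
    simp only [Matrix.inv_def, Ring.inverse_eq_inv', Matrix.smul_apply, smul_eq_mul,
      Matrix.adjugate_apply]
    refine ContDiffAt.mul (ContDiffAt.inv (hdet _ fun a b => hG a b)
      (det_pullbackMetric_ne_zero (injective_mfderiv_extChartAt_symm hy))) (hdet _ fun a b => ?_)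
    by_cases h : a = l
    · subst h
      simp only [Matrix.updateRow_self]
      exact contDiffAt_const
    · simp only [Matrix.updateRow_ne h]
      exact hG a b
  unfold christoffel
  exact contDiffAt_const.mul (ContDiffAt.sum fun l _ =>
    (hinv l).mul (((hp _ _ _).add (hp _ _ _)).sub (hp _ _ _)))

end Metric

end RiemGeom

/-! ### Geodesics and the exponential map -/

namespace RiemGeom
open Set Filter

section Geodesic

variable {d : ℕ} {M : Type*} [MetricSpace M] [ChartedSpace (EuclideanSpace ℝ (Fin d)) M]
  [RiemannianBundle (fun x : M => TangentSpace (𝓡 d) x)]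

/-- The geodesic spray in the chart at `x₀`: the first order system for `(c, c')` equivalent to the
geodesic equation `cₖ'' + ∑ᵢⱼ Γᵏᵢⱼ(c) cᵢ' cⱼ' = 0`. -/
def geodesicField (x₀ : M) (q : EuclideanSpace ℝ (Fin d) × EuclideanSpace ℝ (Fin d)) :
    EuclideanSpace ℝ (Fin d) × EuclideanSpace ℝ (Fin d) :=
  (q.2, WithLp.toLp 2 fun k => -∑ i : Fin d, ∑ j : Fin d,
    christoffel (pullbackMetric (M := M) (extChartAt (𝓡 d) x₀).symm) k i j q.1 * q.2 i * q.2 j)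

lemma hasDerivAt_euclidean_apply {c : ℝ → EuclideanSpace ℝ (Fin d)} {c' : EuclideanSpace ℝ (Fin d)}
    {t : ℝ} (h : HasDerivAt c c' t) (k : Fin d) : HasDerivAt (fun s => c s k) (c' k) t :=
  (EuclideanSpace.proj k : EuclideanSpace ℝ (Fin d) →L[ℝ] ℝ).hasFDerivAt.comp_hasDerivAt t h

variable [IsManifold (𝓡 d) ω M]

omit [RiemannianBundle (fun x : M => TangentSpace (𝓡 d) x)] in
lemma contDiffAt_extChartAt_comp {V : Type*} [NormedAddCommGroup V] [NormedSpace ℝ V] {x₀ : M}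
    {γ : V → M} {t : V} {n : WithTop ℕ∞} (hγ : ContMDiffAt 𝓘(ℝ, V) (𝓡 d) n γ t)
    (ht : γ t ∈ (extChartAt (𝓡 d) x₀).source) :
    ContDiffAt ℝ n (fun s => extChartAt (𝓡 d) x₀ (γ s)) t :=
  (((contMDiffAt_extChartAt_of_mem ht).of_le le_top).comp t hγ).contDiffAt

omit [RiemannianBundle (fun x : M => TangentSpace (𝓡 d) x)] [IsManifold (𝓡 d) ω M] in
lemma eventually_mem_chart_source {V : Type*} [TopologicalSpace V] {x₀ : M} {γ : V → M} {t : V}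
    (hγ : ContinuousAt γ t) (ht : γ t ∈ (extChartAt (𝓡 d) x₀).source) :
    ∀ᶠ s in 𝓝 t, γ s ∈ (extChartAt (𝓡 d) x₀).source :=
  hγ.eventually_mem ((isOpen_extChartAt_source x₀).mem_nhds ht)

/-- The pullback of the metric under `F`, computed in the chart at `x₀`. -/
lemma pullbackForm_chart {F : EuclideanSpace ℝ (Fin d) → M} {y : EuclideanSpace ℝ (Fin d)}
    {x₀ : M} (hF : ContMDiffAt (𝓡 d) (𝓡 d) 1 F y) (hy : F y ∈ (extChartAt (𝓡 d) x₀).source)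
    (u w : EuclideanSpace ℝ (Fin d)) :
    pullbackForm F y u w = pullbackForm (extChartAt (𝓡 d) x₀).symm (extChartAt (𝓡 d) x₀ (F y))
      (fderiv ℝ (fun y => extChartAt (𝓡 d) x₀ (F y)) y u)
      (fderiv ℝ (fun y => extChartAt (𝓡 d) x₀ (F y)) y w) := by
  have hloc : F =ᶠ[𝓝 y] (extChartAt (𝓡 d) x₀).symm ∘ fun y => extChartAt (𝓡 d) x₀ (F y) := by
    filter_upwards [eventually_mem_chart_source hF.continuousAt hy] with z hz
    exact ((extChartAt (𝓡 d) x₀).left_inv hz).symm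
  rw [pullbackForm_congr hloc, pullbackForm_comp
    ((contMDiffAt_extChartAt_symm ((extChartAt (𝓡 d) x₀).map_source hy)).mdifferentiableAt
      (by simp)) ((contDiffAt_extChartAt_comp hF hy).differentiableAt (by simp))]

/-- In a chart, position and velocity of a geodesic form an integral curve of `geodesicField`. -/
lemma IsGeodesic.hasDerivAt {γ : ℝ → M} (hγ : IsGeodesic d γ) {x₀ : M} {t : ℝ}
    (ht : γ t ∈ (extChartAt (𝓡 d) x₀).source) :
    HasDerivAt (fun s => (extChartAt (𝓡 d) x₀ (γ s),
        deriv (fun s => extChartAt (𝓡 d) x₀ (γ s)) s))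
      (geodesicField x₀ (extChartAt (𝓡 d) x₀ (γ t),
        deriv (fun s => extChartAt (𝓡 d) x₀ (γ s)) t)) t := by
  set c : ℝ → EuclideanSpace ℝ (Fin d) := fun s => extChartAt (𝓡 d) x₀ (γ s) with hc
  have hcd : ContDiffAt ℝ ∞ c t := contDiffAt_extChartAt_comp hγ.1.contMDiffAt ht
  have hcd' : ∀ᶠ s in 𝓝 t, HasDerivAt c (deriv c s) s := by
    have h2 : ContDiffAt ℝ 2 c t := hcd.of_le ENat.LEInfty.out
    filter_upwards [h2.eventually (by simp)] with s hs
    exact (hs.differentiableAt (by simp)).hasDerivAt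
  have hdd : DifferentiableAt ℝ (deriv c) t := by
    have h2 : ContDiffAt ℝ 2 c t := hcd.of_le ENat.LEInfty.out
    have := (h2.fderiv_right (m := 1) (by norm_num)).differentiableAt (by simp)
    exact this.clm_apply (differentiableAt_const (1 : ℝ))
  refine hcd'.self_of_nhds.prodMk ?_
  have hgoal : deriv (deriv c) t = (geodesicField x₀ (c t, deriv c t)).2 := by
    ext k
    have hk := hγ.2 x₀ t ht k
    have e1 : ∀ i, deriv (fun s => extChartAt (𝓡 d) x₀ (γ s) i) =ᶠ[𝓝 t] fun s => deriv c s i := by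
      intro i
      filter_upwards [hcd'] with s hs
      exact (hasDerivAt_euclidean_apply hs i).deriv
    have e2 : iteratedDeriv 2 (fun s => extChartAt (𝓡 d) x₀ (γ s) k) t = deriv (deriv c) t k := by
      rw [iteratedDeriv_succ, iteratedDeriv_one, (e1 k).deriv_eq]
      exact (hasDerivAt_euclidean_apply hdd.hasDerivAt k).deriv
    rw [e2] at hk
    simp only [(e1 _).self_of_nhds] at hk
    exact eq_neg_of_add_eq_zero_left hk
  have h := hdd.hasDerivAt
  rw [hgoal] at h
  exact h

lemma contDiffAt_geodesicField [IsContMDiffRiemannianBundle (𝓡 d) ω (EuclideanSpace ℝ (Fin d))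
      (fun x : M => TangentSpace (𝓡 d) x)] {x₀ : M}
    {q : EuclideanSpace ℝ (Fin d) × EuclideanSpace ℝ (Fin d)}
    (hq : q.1 ∈ (extChartAt (𝓡 d) x₀).target) : ContDiffAt ℝ ω (geodesicField x₀) q := by
  refine contDiffAt_snd.prodMk ?_
  rw [contDiffAt_euclidean]
  intro k
  have hcomp : ∀ i : Fin d, ContDiffAt ℝ ω
      (fun q : EuclideanSpace ℝ (Fin d) × EuclideanSpace ℝ (Fin d) => q.2 i) q := fun i =>
    (contDiffAt_euclidean.1 contDiffAt_snd) i
  exact (ContDiffAt.sum fun i _ => ContDiffAt.sum fun j _ =>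
    (((contDiffAt_christoffel hq k i j).comp q contDiffAt_fst).mul (hcomp i)).mul (hcomp j)).neg

variable [IsContMDiffRiemannianBundle (𝓡 d) ω (EuclideanSpace ℝ (Fin d))
      (fun x : M => TangentSpace (𝓡 d) x)]

/-- Local uniqueness of geodesics. -/
lemma IsGeodesic.eventuallyEq {γ₁ γ₂ : ℝ → M} (h₁ : IsGeodesic d γ₁) (h₂ : IsGeodesic d γ₂)
    {x₀ : M} {t : ℝ} (ht : γ₁ t ∈ (extChartAt (𝓡 d) x₀).source) (h0 : γ₁ t = γ₂ t)
    (hd : deriv (fun s => extChartAt (𝓡 d) x₀ (γ₁ s)) t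
      = deriv (fun s => extChartAt (𝓡 d) x₀ (γ₂ s)) t) : γ₁ =ᶠ[𝓝 t] γ₂ := by
  have ht₂ : γ₂ t ∈ (extChartAt (𝓡 d) x₀).source := h0 ▸ ht
  have s₁ := eventually_mem_chart_source h₁.1.continuous.continuousAt ht
  have s₂ := eventually_mem_chart_source h₂.1.continuous.continuousAt ht₂
  obtain ⟨K, s, hs, hlip⟩ := ((contDiffAt_geodesicField (x₀ := x₀)
    (q := (extChartAt (𝓡 d) x₀ (γ₁ t), deriv (fun s => extChartAt (𝓡 d) x₀ (γ₁ s)) t))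
    ((extChartAt (𝓡 d) x₀).map_source ht)).of_le
      (m := 1) le_top).exists_lipschitzOnWith
  have hu := ODE_solution_unique_of_eventually (v := fun _ => geodesicField x₀) (s := fun _ => s)
    (t₀ := t) (K := K)
    (f := fun s => (extChartAt (𝓡 d) x₀ (γ₁ s), deriv (fun s => extChartAt (𝓡 d) x₀ (γ₁ s)) s))
    (g := fun s => (extChartAt (𝓡 d) x₀ (γ₂ s), deriv (fun s => extChartAt (𝓡 d) x₀ (γ₂ s)) s))
    (Eventually.of_forall fun _ => hlip)
    (by
      filter_upwards [s₁, (h₁.hasDerivAt ht).continuousAt.eventually_mem hs] with r hr hr'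
      exact ⟨h₁.hasDerivAt hr, hr'⟩)
    (by
      have hs' := hs
      rw [hd, h0] at hs'
      filter_upwards [s₂, (h₂.hasDerivAt ht₂).continuousAt.eventually_mem hs'] with r hr hr'
      exact ⟨h₂.hasDerivAt hr, hr'⟩)
    (by simp only [h0, hd])
  filter_upwards [hu, s₁, s₂] with r hr hr₁ hr₂
  exact (extChartAt (𝓡 d) x₀).injOn hr₁ hr₂ (congrArg Prod.fst hr)

/-- Geodesics which agree near one time agree at all times: the set of such times is open by
definition and closed by local uniqueness. -/
lemma IsGeodesic.eq_of_eventuallyEq {γ₁ γ₂ : ℝ → M} (h₁ : IsGeodesic d γ₁)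
    (h₂ : IsGeodesic d γ₂) {t₀ : ℝ} (h : γ₁ =ᶠ[𝓝 t₀] γ₂) : γ₁ = γ₂ := by
  let S : Set ℝ := {t | γ₁ =ᶠ[𝓝 t] γ₂}
  have hopen : IsOpen S := isOpen_setOfPred_eventually_nhds
  have hclosed : IsClosed S := by
    rw [← closure_subset_iff_isClosed]
    intro t ht
    have hfr : ∃ᶠ s in 𝓝 t, s ∈ S := mem_closure_iff_frequently.1 ht
    have c₁ := h₁.1.continuous
    have c₂ := h₂.1.continuous
    have h0 : γ₁ t = γ₂ t := by
      have hcl : IsClosed {s | γ₁ s = γ₂ s} := isClosed_eq c₁ c₂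
      exact hcl.closure_subset_iff.2 (fun s hs => hs.self_of_nhds) ht
    have hsrc : γ₁ t ∈ (extChartAt (𝓡 d) (γ₁ t)).source := mem_extChartAt_source _
    have k₁ := (h₁.hasDerivAt hsrc).continuousAt
    have k₂ := (h₂.hasDerivAt (x₀ := γ₁ t) (t := t) (h0 ▸ hsrc)).continuousAt
    have hlim : (fun s => (extChartAt (𝓡 d) (γ₁ t) (γ₁ s),
        deriv (fun s => extChartAt (𝓡 d) (γ₁ t) (γ₁ s)) s)) t
        = (fun s => (extChartAt (𝓡 d) (γ₁ t) (γ₂ s),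
        deriv (fun s => extChartAt (𝓡 d) (γ₁ t) (γ₂ s)) s)) t := by
      refine tendsto_nhds_unique_of_frequently_eq k₁ k₂ (hfr.mono fun s hs => ?_)
      have hs' : γ₁ =ᶠ[𝓝 s] γ₂ := hs
      have e : (fun s => extChartAt (𝓡 d) (γ₁ t) (γ₁ s)) =ᶠ[𝓝 s]
          fun s => extChartAt (𝓡 d) (γ₁ t) (γ₂ s) := hs'.fun_comp _
      exact Prod.ext e.self_of_nhds e.deriv_eq
    exact h₁.eventuallyEq h₂ hsrc h0 (congrArg Prod.snd hlim)
  have huniv : S = univ := IsClopen.eq_univ ⟨hclosed, hopen⟩ ⟨t₀, h⟩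
  funext t
  have : γ₁ =ᶠ[𝓝 t] γ₂ := (huniv ▸ mem_univ t : t ∈ S)
  exact this.self_of_nhds

omit [RiemannianBundle (fun x : M => TangentSpace (𝓡 d) x)]
  [IsContMDiffRiemannianBundle (𝓡 d) ω (EuclideanSpace ℝ (Fin d))
      (fun x : M => TangentSpace (𝓡 d) x)] in
lemma deriv_extChartAt_comp_eq_tangentMap {γ : ℝ → M} (hγ : ContMDiff 𝓘(ℝ, ℝ) (𝓡 d) ∞ γ) {x₀ : M}
    {t : ℝ} (ht : γ t ∈ (extChartAt (𝓡 d) x₀).source) :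
    deriv (fun s => extChartAt (𝓡 d) x₀ (γ s)) t
      = (tangentMap (𝓡 d) (𝓡 d) (extChartAt (𝓡 d) x₀)
          (tangentMap 𝓘(ℝ, ℝ) (𝓡 d) γ ⟨t, (1 : ℝ)⟩)).2 := by
  have h := tangentMap_comp_at (I := 𝓘(ℝ, ℝ)) (I' := 𝓡 d) (I'' := 𝓡 d)
    (g := extChartAt (𝓡 d) x₀) (f := γ) ⟨t, (1 : ℝ)⟩
    ((contMDiffAt_extChartAt_of_mem ht).mdifferentiableAt (by simp))
    (hγ.mdifferentiable (by simp) t)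
  rw [← h, tangentMap, mfderiv_eq_fderiv]
  rfl

omit [IsManifold (𝓡 d) ω M] [IsContMDiffRiemannianBundle (𝓡 d) ω (EuclideanSpace ℝ (Fin d))
      (fun x : M => TangentSpace (𝓡 d) x)] in
lemma IsGeodesicFrom.apply_zero {p : M} {v : TangentSpace (𝓡 d) p} {γ : ℝ → M}
    (h : IsGeodesicFrom p v γ) : γ 0 = p :=
  congrArg Sigma.fst (congrArg (fun X : TangentBundle (𝓡 d) M =>
    (⟨X.1, X.2⟩ : Σ x : M, TangentSpace (𝓡 d) x)) h.2)

/-- A geodesic is determined by its initial point and velocity. -/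
lemma IsGeodesicFrom.unique {p : M} {v : TangentSpace (𝓡 d) p} {γ₁ γ₂ : ℝ → M}
    (h₁ : IsGeodesicFrom p v γ₁) (h₂ : IsGeodesicFrom p v γ₂) : γ₁ = γ₂ := by
  have e₁ := h₁.apply_zero
  have e₂ := h₂.apply_zero
  have hsrc : p ∈ (extChartAt (𝓡 d) p).source := mem_extChartAt_source _
  refine h₁.1.eq_of_eventuallyEq h₂.1 (t₀ := 0)
    (h₁.1.eventuallyEq h₂.1 (x₀ := p) (by rwa [e₁]) (e₁.trans e₂.symm) ?_)
  rw [deriv_extChartAt_comp_eq_tangentMap h₁.1.1 (by rwa [e₁]),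
    deriv_extChartAt_comp_eq_tangentMap h₂.1.1 (by rwa [e₂]), h₁.2, h₂.2]

omit [IsManifold (𝓡 d) ω M] [IsContMDiffRiemannianBundle (𝓡 d) ω (EuclideanSpace ℝ (Fin d))
      (fun x : M => TangentSpace (𝓡 d) x)] in
/-- Linear reparametrisations of geodesics are geodesics. -/
lemma IsGeodesicFrom.comp_mul {p : M} {v : TangentSpace (𝓡 d) p} {γ : ℝ → M}
    (h : IsGeodesicFrom p v γ) (a : ℝ) : IsGeodesicFrom p (a • v) (fun t => γ (a * t)) := by
  have hmul : ContMDiff 𝓘(ℝ, ℝ) 𝓘(ℝ, ℝ) ∞ (fun t : ℝ => a * t) :=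
    (contDiff_const.mul contDiff_id).contMDiff
  refine ⟨⟨h.1.1.comp hmul, ?_⟩, ?_⟩
  · intro x₀ t ht k
    have hd : ∀ f : ℝ → ℝ, ∀ t, deriv (fun s => f (a * s)) t = a * deriv f (a * t) := by
      intro f t
      simpa using deriv_comp_mul_left a f t
    have hk := h.1.2 x₀ (a * t) ht k
    have h2 : iteratedDeriv 2 (fun s => extChartAt (𝓡 d) x₀ (γ (a * s)) k) t
        = a ^ 2 * iteratedDeriv 2 (fun s => extChartAt (𝓡 d) x₀ (γ s) k) (a * t) := by
      rw [iteratedDeriv_succ, iteratedDeriv_one, iteratedDeriv_succ, iteratedDeriv_one]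
      have : deriv (fun s => extChartAt (𝓡 d) x₀ (γ (a * s)) k)
          = fun s => a * deriv (fun s => extChartAt (𝓡 d) x₀ (γ s) k) (a * s) :=
        funext (hd fun s => extChartAt (𝓡 d) x₀ (γ s) k)
      rw [this, deriv_const_mul_field, hd]
      ring
    rw [h2]
    have h1 : ∀ i, deriv (fun s => extChartAt (𝓡 d) x₀ (γ (a * s)) i) t
        = a * deriv (fun s => extChartAt (𝓡 d) x₀ (γ s) i) (a * t) := fun i =>
      hd (fun s => extChartAt (𝓡 d) x₀ (γ s) i) t
    simp only [h1]
    have := congrArg (fun x => a ^ 2 * x) hk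
    simp only [mul_zero, mul_add, Finset.mul_sum] at this
    rw [← this]
    congr 1
    refine Finset.sum_congr rfl fun i _ => Finset.sum_congr rfl fun j _ => by ring
  · have hcomp := tangentMap_comp_at (I := 𝓘(ℝ, ℝ)) (I' := 𝓘(ℝ, ℝ)) (I'' := 𝓡 d)
      (g := γ) (f := fun t : ℝ => a * t) ⟨0, (1 : ℝ)⟩
      (h.1.1.mdifferentiable (by simp) _) (hmul.mdifferentiable (by simp) _)
    have e1 : tangentMap 𝓘(ℝ, ℝ) 𝓘(ℝ, ℝ) (fun t : ℝ => a * t) ⟨0, (1 : ℝ)⟩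
        = (⟨a * 0, a⟩ : TangentBundle 𝓘(ℝ, ℝ) ℝ) := by
      rw [tangentMap, mfderiv_eq_fderiv]
      have : fderiv ℝ (fun t : ℝ => a * t) 0 (1 : ℝ) = a := by simp
      exact congrArg (fun z => (⟨a * 0, z⟩ : TangentBundle 𝓘(ℝ, ℝ) ℝ)) this
    have e2 : ∀ s : ℝ, s = 0 → tangentMap 𝓘(ℝ, ℝ) (𝓡 d) γ ⟨s, a⟩
        = (⟨p, a • v⟩ : TangentBundle (𝓡 d) M) := by
      rintro s rfl
      have hlin : mfderiv 𝓘(ℝ, ℝ) (𝓡 d) γ 0 a = a • mfderiv 𝓘(ℝ, ℝ) (𝓡 d) γ 0 (1 : ℝ) :=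
        (congrArg (mfderiv 𝓘(ℝ, ℝ) (𝓡 d) γ 0) (mul_one a).symm).trans
          (map_smul (mfderiv 𝓘(ℝ, ℝ) (𝓡 d) γ 0) a (1 : ℝ))
      have hscale := congrArg (fun X : TangentBundle (𝓡 d) M =>
        (⟨X.1, a • X.2⟩ : TangentBundle (𝓡 d) M)) h.2
      exact (congrArg (fun z => (⟨γ 0, z⟩ : TangentBundle (𝓡 d) M)) hlin).trans hscale
    change tangentMap 𝓘(ℝ, ℝ) (𝓡 d) (γ ∘ fun t : ℝ => a * t) ⟨0, (1 : ℝ)⟩ = _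
    rw [hcomp, e1, e2 _ (mul_zero a)]

lemma IsGeodesicFrom.expMap_smul {p : M} {v : TangentSpace (𝓡 d) p} {γ : ℝ → M}
    (h : IsGeodesicFrom p v γ) (a : ℝ) : expMap p (a • v) = γ a := by
  have hex : ∃ γ : ℝ → M, IsGeodesicFrom p (a • v) γ := ⟨_, h.comp_mul a⟩
  rw [expMap, dif_pos hex, hex.choose_spec.unique (h.comp_mul a)]
  simp only [mul_one]

lemma expMap_zero (p : M) : expMap p (0 : TangentSpace (𝓡 d) p) = p := by
  by_cases h : ∃ γ : ℝ → M, IsGeodesicFrom p (0 : TangentSpace (𝓡 d) p) γ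
  · obtain ⟨γ, hγ⟩ := h
    rw [← zero_smul ℝ (0 : TangentSpace (𝓡 d) p), hγ.expMap_smul, hγ.apply_zero]
  · rw [expMap, dif_neg h]

/-- In the domain of injectivity of the exponential map all geodesics exist: where there is no
geodesic `expMap` takes its default value `p`, which is already the image of `0`. -/
lemma exists_isGeodesicFrom_of_injOn {p : M} {r : ℝ}
    (hinj : InjOn (expMap p) (Metric.ball (0 : TangentSpace (𝓡 d) p) r))
    {v : TangentSpace (𝓡 d) p} (hv : ‖v‖ < r) (hv0 : v ≠ 0) :
    ∃ γ : ℝ → M, IsGeodesicFrom p v γ := by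
  by_contra h
  refine hv0 (hinj (mem_ball_zero_iff.2 hv) (Metric.mem_ball_self ?_) ?_)
  · exact (norm_nonneg v).trans_lt hv
  · rw [expMap_zero, expMap, dif_neg h]

end Geodesic

end RiemGeom

/-! ### Normal coordinates and Jacobi fields -/

namespace RiemGeom
open Set Filter

section Flat

/-- A smooth function all of whose derivatives vanish at `0` vanishes at `v` as soon as `t² f(t v)`
is an analytic function of `t` on a connected set of times containing `0` and `1`. -/
lemma eq_zero_of_flat_of_analyticAt {V : Type*} [NormedAddCommGroup V] [NormedSpace ℝ V]
    {f : V → ℝ} {U : Set V} {v : V} (hU : IsOpen U) (hf : ContDiffOn ℝ ∞ f U)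
    (hflat : ∀ n, iteratedFDeriv ℝ n f 0 = 0) (h0 : (0 : V) ∈ U) (hv : v ∈ U)
    (hI : IsPreconnected ((fun t : ℝ => t • v) ⁻¹' U))
    (hana : ∀ t : ℝ, t • v ∈ U → AnalyticAt ℝ (fun t : ℝ => t ^ 2 * f (t • v)) t) : f v = 0 := by
  let g : ℝ →L[ℝ] V := (ContinuousLinearMap.id ℝ ℝ).smulRight v
  have hg : ∀ t, g t = t • v := fun t => rfl
  have hgo : IsOpen (g ⁻¹' U) := hU.preimage g.continuous
  have h0' : (0 : ℝ) ∈ g ⁻¹' U := by simpa using h0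
  have hfg : ContDiffOn ℝ ∞ (f ∘ g) (g ⁻¹' U) := hf.comp g.contDiff.contDiffOn fun t ht => ht
  have hk : ∀ n : ℕ, iteratedFDerivWithin ℝ n (f ∘ g) (g ⁻¹' U) 0 = 0 := by
    intro n
    rw [g.iteratedFDerivWithin_comp_right hf hU.uniqueDiffOn hgo.uniqueDiffOn h0'
      (i := n) (by exact_mod_cast le_top), map_zero, iteratedFDerivWithin_of_isOpen n hU h0, hflat]
    rfl
  have hD : ∀ n : ℕ, iteratedFDeriv ℝ n (fun t : ℝ => t ^ 2 * (f ∘ g) t) 0 = 0 := by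
    intro n
    rw [← iteratedFDerivWithin_of_isOpen n hgo h0', ← norm_le_zero_iff]
    refine (norm_iteratedFDerivWithin_mul_le (N := ∞) (f := fun t : ℝ => t ^ 2)
      (by fun_prop) hfg hgo.uniqueDiffOn h0' (by exact_mod_cast le_top)).trans ?_
    simp [hk]
  have hA : AnalyticAt ℝ (fun t : ℝ => t ^ 2 * f (t • v)) 0 := hana 0 (by simpa using h0)
  have hz : (fun t : ℝ => t ^ 2 * f (t • v)) =ᶠ[𝓝 0] 0 := by
    have hp := hA.hasFPowerSeriesAt
    have hc : (fun n : ℕ => iteratedDeriv n (fun t : ℝ => t ^ 2 * f (t • v)) 0 / n.factorial)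
        = 0 := by
      funext n
      have := hD n
      simp only [Function.comp_def, hg] at this
      rw [iteratedDeriv_eq_iteratedFDeriv, this]
      simp
    rw [hc, FormalMultilinearSeries.ofScalars_series_eq_zero_of_scalar_zero] at hp
    exact hp.eventually_eq_zero
  have hfin := AnalyticOnNhd.eqOn_zero_of_preconnected_of_eventuallyEq_zero
    (f := fun t : ℝ => t ^ 2 * f (t • v)) (fun t ht => hana t ht) hI h0' hz
  have h1 : (1 : ℝ) ∈ g ⁻¹' U := by
    rw [mem_preimage, hg, one_smul]
    exact hv
  simpa using hfin h1

end Flat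

section NormalMap

variable {d : ℕ} {M : Type*} [MetricSpace M] [ChartedSpace (EuclideanSpace ℝ (Fin d)) M]
  [RiemannianBundle (fun x : M => TangentSpace (𝓡 d) x)] {β : Frame d M} {r : ℝ}

lemma norm_frame_repr_symm (x : EuclideanSpace ℝ (Fin d)) : ‖β.basis.repr.symm x‖ = ‖x‖ :=
  β.basis.repr.symm.norm_map x

lemma exists_partialDiffeomorph_normalMap (hr : IsExpDiffeo d β.pt r) :
    ∃ Φ : PartialDiffeomorph 𝓘(ℝ, TangentSpace (𝓡 d) β.pt) (𝓡 d) (TangentSpace (𝓡 d) β.pt) M ∞,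
      Φ.source = Metric.ball (0 : TangentSpace (𝓡 d) β.pt) r ∧ Φ.target = Metric.ball β.pt r ∧
      ∀ x ∈ Metric.ball (0 : EuclideanSpace ℝ (Fin d)) r,
        normalMap β x = Φ (β.basis.repr.symm x) := by
  obtain ⟨Φ, h1, h2, h3⟩ := hr
  refine ⟨Φ, h1, h2, fun x hx => h3 ?_⟩
  rw [mem_ball_zero_iff] at hx ⊢
  rwa [norm_frame_repr_symm]

lemma frame_repr_symm_mem_ball {x : EuclideanSpace ℝ (Fin d)}
    (hx : x ∈ Metric.ball (0 : EuclideanSpace ℝ (Fin d)) r) :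
    β.basis.repr.symm x ∈ Metric.ball (0 : TangentSpace (𝓡 d) β.pt) r := by
  rw [mem_ball_zero_iff] at hx ⊢
  rwa [norm_frame_repr_symm]

lemma contMDiffOn_normalMap (hr : IsExpDiffeo d β.pt r) :
    ContMDiffOn (𝓡 d) (𝓡 d) ∞ (normalMap β) (Metric.ball 0 r) := by
  obtain ⟨Φ, h1, h2, h3⟩ := exists_partialDiffeomorph_normalMap hr
  have hL : ContMDiff (𝓡 d) 𝓘(ℝ, TangentSpace (𝓡 d) β.pt) ∞ β.basis.repr.symm :=
    β.basis.repr.symm.contDiff.contMDiff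
  refine (Φ.contMDiffOn_toFun.comp hL.contMDiffOn fun x hx => ?_).congr h3
  rw [mem_preimage, h1]
  exact frame_repr_symm_mem_ball hx

lemma injOn_normalMap (hr : IsExpDiffeo d β.pt r) :
    InjOn (normalMap β) (Metric.ball 0 r) := by
  obtain ⟨Φ, h1, h2, h3⟩ := exists_partialDiffeomorph_normalMap hr
  intro x hx y hy hxy
  rw [h3 x hx, h3 y hy] at hxy
  refine β.basis.repr.symm.injective (Φ.injOn ?_ ?_ hxy) <;> rw [h1] <;>
    exact frame_repr_symm_mem_ball ‹_›

lemma image_normalMap (hr : IsExpDiffeo d β.pt r) :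
    normalMap β '' Metric.ball 0 r = Metric.ball β.pt r := by
  obtain ⟨Φ, h1, h2, h3⟩ := exists_partialDiffeomorph_normalMap hr
  rw [← h2, ← Φ.image_source_eq_target, h1]
  ext q
  constructor
  · rintro ⟨x, hx, rfl⟩
    exact ⟨_, frame_repr_symm_mem_ball hx, (h3 x hx).symm⟩
  · rintro ⟨v, hv, rfl⟩
    have hx : β.basis.repr v ∈ Metric.ball (0 : EuclideanSpace ℝ (Fin d)) r := by
      rw [mem_ball_zero_iff] at hv ⊢
      rwa [β.basis.repr.norm_map]
    refine ⟨β.basis.repr v, hx, ?_⟩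
    rw [h3 _ hx, LinearIsometryEquiv.symm_apply_apply]

lemma injOn_normalMap_injRad (β : Frame d M) :
    InjOn (normalMap β) {x | ENNReal.ofReal ‖x‖ < injRad d β.pt} := by
  intro x hx y hy hxy
  have hmax : max (ENNReal.ofReal ‖x‖) (ENNReal.ofReal ‖y‖) < injRad d β.pt := max_lt hx hy
  obtain ⟨_, ⟨r, ⟨hr0, hr⟩, rfl⟩, hlt⟩ := lt_sSup_iff.1 hmax
  rw [max_lt_iff, ENNReal.ofReal_lt_ofReal_iff hr0, ENNReal.ofReal_lt_ofReal_iff hr0] at hlt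
  exact injOn_normalMap hr (mem_ball_zero_iff.2 hlt.1) (mem_ball_zero_iff.2 hlt.2) hxy

lemma normalCoord_normalMap (hr0 : 0 < r) (hr : IsExpDiffeo d β.pt r)
    {x : EuclideanSpace ℝ (Fin d)} (hx : x ∈ Metric.ball (0 : EuclideanSpace ℝ (Fin d)) r) :
    normalCoord β (normalMap β x) = x := by
  refine (injOn_normalMap_injRad β).leftInvOn_invFunOn ?_
  have hle : ENNReal.ofReal r ≤ injRad d β.pt := le_sSup ⟨r, ⟨hr0, hr⟩, rfl⟩
  refine lt_of_lt_of_le ?_ hle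
  rw [ENNReal.ofReal_lt_ofReal_iff hr0]
  exact mem_ball_zero_iff.1 hx

lemma normalCoord_mem_ball (hr0 : 0 < r) (hr : IsExpDiffeo d β.pt r) {q : M}
    (hq : q ∈ Metric.ball β.pt r) : normalCoord β q ∈ Metric.ball 0 r := by
  rw [← image_normalMap hr] at hq
  obtain ⟨x, hx, rfl⟩ := hq
  rwa [normalCoord_normalMap hr0 hr hx]

lemma normalMap_normalCoord (hr0 : 0 < r) (hr : IsExpDiffeo d β.pt r) {q : M}
    (hq : q ∈ Metric.ball β.pt r) : normalMap β (normalCoord β q) = q := by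
  rw [← image_normalMap hr] at hq
  obtain ⟨x, hx, rfl⟩ := hq
  rw [normalCoord_normalMap hr0 hr hx]

lemma normalMap_mem_ball (hr : IsExpDiffeo d β.pt r) {x : EuclideanSpace ℝ (Fin d)}
    (hx : x ∈ Metric.ball (0 : EuclideanSpace ℝ (Fin d)) r) :
    normalMap β x ∈ Metric.ball β.pt r :=
  image_normalMap hr ▸ mem_image_of_mem _ hx

lemma contMDiffOn_normalCoord (hr0 : 0 < r) (hr : IsExpDiffeo d β.pt r) :
    ContMDiffOn (𝓡 d) (𝓡 d) ∞ (normalCoord β) (Metric.ball β.pt r) := by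
  obtain ⟨Φ, h1, h2, h3⟩ := exists_partialDiffeomorph_normalMap hr
  have hL : ContMDiff 𝓘(ℝ, TangentSpace (𝓡 d) β.pt) (𝓡 d) ∞ β.basis.repr :=
    β.basis.repr.contDiff.contMDiff
  have hinv := Φ.contMDiffOn_invFun
  rw [h2] at hinv
  refine (hL.comp_contMDiffOn hinv).congr fun q hq => ?_
  have hx := normalCoord_mem_ball hr0 hr hq
  have hq' := normalMap_normalCoord hr0 hr hq
  rw [h3 _ hx] at hq'
  have h4 : Φ.toPartialEquiv.symm q = β.basis.repr.symm (normalCoord β q) := by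
    conv_lhs => rw [← hq']
    refine Φ.toPartialEquiv.left_inv ?_
    rw [h1]
    exact frame_repr_symm_mem_ball hx
  change _ = β.basis.repr (Φ.toPartialEquiv.symm q)
  rw [h4, LinearIsometryEquiv.apply_symm_apply]

lemma mfderiv_normalCoord_comp_normalMap (hr0 : 0 < r) (hr : IsExpDiffeo d β.pt r)
    {x : EuclideanSpace ℝ (Fin d)} (hx : x ∈ Metric.ball (0 : EuclideanSpace ℝ (Fin d)) r)
    (u : EuclideanSpace ℝ (Fin d)) :
    mfderiv (𝓡 d) (𝓡 d) (normalCoord β) (normalMap β x) (mfderiv (𝓡 d) (𝓡 d) (normalMap β) x u)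
      = u := by
  have hφ : MDifferentiableAt (𝓡 d) (𝓡 d) (normalMap β) x :=
    ((contMDiffOn_normalMap hr).contMDiffAt (Metric.isOpen_ball.mem_nhds hx)).mdifferentiableAt
      (by simp)
  have hc : MDifferentiableAt (𝓡 d) (𝓡 d) (normalCoord β) (normalMap β x) :=
    ((contMDiffOn_normalCoord hr0 hr).contMDiffAt
      (Metric.isOpen_ball.mem_nhds (normalMap_mem_ball hr hx))).mdifferentiableAt (by simp)
  have hid : normalCoord β ∘ normalMap β =ᶠ[𝓝 x] id := by
    filter_upwards [Metric.isOpen_ball.mem_nhds hx] with y hy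
    exact normalCoord_normalMap hr0 hr hy
  have h := mfderiv_comp x hc hφ
  rw [hid.mfderiv_eq, mfderiv_id] at h
  exact (congrArg (fun A : EuclideanSpace ℝ (Fin d) →L[ℝ] EuclideanSpace ℝ (Fin d) => A u) h).symm

lemma injective_mfderiv_normalMap (hr0 : 0 < r) (hr : IsExpDiffeo d β.pt r)
    {x : EuclideanSpace ℝ (Fin d)} (hx : x ∈ Metric.ball (0 : EuclideanSpace ℝ (Fin d)) r) :
    Function.Injective (mfderiv (𝓡 d) (𝓡 d) (normalMap β) x) := by
  intro u w huw
  rw [← mfderiv_normalCoord_comp_normalMap hr0 hr hx u, huw,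
    mfderiv_normalCoord_comp_normalMap hr0 hr hx w]

variable [IsManifold (𝓡 d) ω M] [IsContMDiffRiemannianBundle (𝓡 d) ω (EuclideanSpace ℝ (Fin d))
      (fun x : M => TangentSpace (𝓡 d) x)]

lemma normalMap_zero (β : Frame d M) : normalMap β 0 = β.pt := by
  rw [normalMap, map_zero, expMap_zero]

/-- The radial lines of normal coordinates are geodesics. -/
lemma exists_isGeodesic_normalMap_smul (hr : IsExpDiffeo d β.pt r)
    {v : EuclideanSpace ℝ (Fin d)} (hv : v ∈ Metric.ball (0 : EuclideanSpace ℝ (Fin d)) r)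
    (hv0 : v ≠ 0) : ∃ γ : ℝ → M, IsGeodesic d γ ∧ ∀ t : ℝ, normalMap β (t • v) = γ t := by
  have hinj : InjOn (expMap β.pt) (Metric.ball (0 : TangentSpace (𝓡 d) β.pt) r) := by
    obtain ⟨Φ, h1, h2, h3⟩ := hr
    rw [h3.injOn_iff, ← h1]
    exact Φ.injOn
  obtain ⟨γ, hγ⟩ := exists_isGeodesicFrom_of_injOn hinj (v := β.basis.repr.symm v)
    (mem_ball_zero_iff.1 (frame_repr_symm_mem_ball hv)) (by simpa using hv0)
  refine ⟨γ, hγ.1, fun t => ?_⟩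
  rw [normalMap, map_smul, hγ.expMap_smul]

/-- Along a radial line of normal coordinates, the geodesic and the Jacobi fields
`t ↦ d(normalMap) (t v) (t w)` are analytic in every chart. -/
lemma analyticAt_normalMap_ray (hr : IsExpDiffeo d β.pt r)
    {v : EuclideanSpace ℝ (Fin d)} (hv : v ∈ Metric.ball (0 : EuclideanSpace ℝ (Fin d)) r)
    (hv0 : v ≠ 0) {t₀ : ℝ} (ht₀ : t₀ • v ∈ Metric.ball (0 : EuclideanSpace ℝ (Fin d)) r)
    {x₀ : M} (hx₀ : normalMap β (t₀ • v) ∈ (extChartAt (𝓡 d) x₀).source)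
    (w : EuclideanSpace ℝ (Fin d)) :
    AnalyticAt ℝ (fun t : ℝ => extChartAt (𝓡 d) x₀ (normalMap β (t • v))) t₀ ∧
    AnalyticAt ℝ (fun t : ℝ => fderiv ℝ (fun y => extChartAt (𝓡 d) x₀ (normalMap β y))
      (t • v) (t • w)) t₀ := by
  let f : EuclideanSpace ℝ (Fin d) → EuclideanSpace ℝ (Fin d) :=
    fun y => extChartAt (𝓡 d) x₀ (normalMap β y)
  -- the Jacobi field is the variation field of the geodesics `t ↦ t (v + s w)`
  let S : ℝ × ℝ → EuclideanSpace ℝ (Fin d) := fun x => x.1 • (v + x.2 • w)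
  have hS : ContDiff ℝ ω S := by fun_prop
  have hS0 : S (t₀, 0) = t₀ • v := by simp [S]
  have hφ : ContMDiffAt (𝓡 d) (𝓡 d) ∞ (normalMap β) (t₀ • v) :=
    (contMDiffOn_normalMap hr).contMDiffAt (Metric.isOpen_ball.mem_nhds ht₀)
  have hf : ContDiffAt ℝ ∞ f (t₀ • v) := contDiffAt_extChartAt_comp hφ hx₀
  have hf3 : ContDiffAt ℝ 3 f (t₀ • v) := hf.of_le ENat.LEInfty.out
  have hfn : ∀ᶠ y in 𝓝 (t₀ • v), ContDiffAt ℝ 3 f y := hf3.eventually (by simp)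
  let c : ℝ × ℝ → EuclideanSpace ℝ (Fin d) := fun x => f (S x)
  have hc : ContDiffAt ℝ 3 c (t₀, 0) :=
    ContDiffAt.comp (t₀, 0) (g := f) (by rw [hS0]; exact hf3) (hS.contDiffAt.of_le le_top)
  let u : ℝ × ℝ → EuclideanSpace ℝ (Fin d) × EuclideanSpace ℝ (Fin d) :=
    fun x => (c x, fderiv ℝ c x (1, 0))
  have hu : ContDiffAt ℝ 2 u (t₀, 0) :=
    (hc.of_le (by norm_num)).prodMk
      ((hc.fderiv_right (m := 2) (by norm_num)).clm_apply contDiffAt_const)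
  have hc0 : c (t₀, 0) ∈ (extChartAt (𝓡 d) x₀).target := by
    simp only [c, hS0]
    exact (extChartAt (𝓡 d) x₀).map_source hx₀
  have hZ : AnalyticAt ℝ (geodesicField x₀) (u (t₀, 0)) :=
    (contDiffAt_geodesicField (x₀ := x₀) hc0).analyticAt
  have hSc : Tendsto S (𝓝 (t₀, 0)) (𝓝 (t₀ • v)) := by
    rw [← hS0]; exact hS.continuous.continuousAt
  -- all the neighbouring rays are geodesics
  have hode : ∀ᶠ x in 𝓝 ((t₀, 0) : ℝ × ℝ), fderiv ℝ u x (1, 0) = geodesicField x₀ (u x) := by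
    have e1 : ∀ᶠ x in 𝓝 ((t₀, 0) : ℝ × ℝ), normalMap β (S x) ∈ (extChartAt (𝓡 d) x₀).source :=
      hSc.eventually (eventually_mem_chart_source hφ.continuousAt hx₀)
    have e2 : ∀ᶠ x in 𝓝 ((t₀, 0) : ℝ × ℝ),
        v + x.2 • w ∈ Metric.ball (0 : EuclideanSpace ℝ (Fin d)) r \ {0} := by
      have hcont : Continuous fun x : ℝ × ℝ => v + x.2 • w := by fun_prop
      refine hcont.continuousAt.eventually_mem
        ((Metric.isOpen_ball.sdiff isClosed_singleton).mem_nhds ?_)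
      simpa using ⟨by simpa using hv, hv0⟩
    have e3 : ∀ᶠ x in 𝓝 ((t₀, 0) : ℝ × ℝ), ContDiffAt ℝ 3 c x := hc.eventually (by simp)
    have e4 : ∀ᶠ x in 𝓝 ((t₀, 0) : ℝ × ℝ), DifferentiableAt ℝ u x := by
      filter_upwards [hu.eventually (by simp)] with x hx
      exact hx.differentiableAt (by simp)
    filter_upwards [e1, e2, e3.eventually_nhds, e4] with x h1 h2 h3 h4
    obtain ⟨t, s⟩ := x
    obtain ⟨γ, hγ, hγe⟩ := exists_isGeodesic_normalMap_smul hr h2.1 h2.2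
    have hγt : γ t ∈ (extChartAt (𝓡 d) x₀).source := by
      rw [← hγe t]; exact h1
    have hline : ∀ t', HasDerivAt (fun t' : ℝ => ((t', s) : ℝ × ℝ)) (1, 0) t' := fun t' =>
      (hasDerivAt_id t').prodMk (hasDerivAt_const t' s)
    have hcγ : ∀ t', c (t', s) = extChartAt (𝓡 d) x₀ (γ t') := fun t' => by
      simp only [c, f, S]
      rw [hγe]
    have hd : ∀ᶠ t' in 𝓝 t, u (t', s) = (extChartAt (𝓡 d) x₀ (γ t'),
        deriv (fun s => extChartAt (𝓡 d) x₀ (γ s)) t') := by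
      have h3' : ∀ᶠ t' in 𝓝 t, ContDiffAt ℝ 3 c (t', s) :=
        (hline t).continuousAt.eventually h3
      filter_upwards [h3'] with t' ht'
      have hder : HasDerivAt (fun t' => c (t', s)) (fderiv ℝ c (t', s) (1, 0)) t' :=
        HasFDerivAt.comp_hasDerivAt (l := c) t' (ht'.differentiableAt (by simp)).hasFDerivAt
          (hline t')
      simp only [hcγ] at hder
      simp only [u, hcγ, hder.deriv]
    have hd1 := (hγ.hasDerivAt hγt).congr_of_eventuallyEq hd
    rw [← hd.self_of_nhds] at hd1
    exact (HasFDerivAt.comp_hasDerivAt (l := u) t h4.hasFDerivAt (hline t)).unique hd1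
  have hvar := AnalyticODE.analyticAt_variation hu hZ hode
  have hr1 : Tendsto (fun t : ℝ => t • v) (𝓝 t₀) (𝓝 (t₀ • v)) := by
    have : Continuous fun t : ℝ => t • v := by fun_prop
    exact this.continuousAt
  have hl : Tendsto (fun t : ℝ => ((t, 0) : ℝ × ℝ)) (𝓝 t₀) (𝓝 (t₀, 0)) := by
    have : Continuous fun t : ℝ => ((t, 0) : ℝ × ℝ) := by fun_prop
    exact this.continuousAt
  have hS1 : ∀ t : ℝ, S (t, 0) = t • v := fun t => by simp [S]
  constructor
  · refine (analyticAt_fst.comp (analyticAt_fst.comp hvar)).congr (Eventually.of_forall fun t => ?_)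
    simp [u, c, hS1, f]
  · refine (analyticAt_fst.comp (analyticAt_snd.comp hvar)).congr ?_
    have e4 : ∀ᶠ t in 𝓝 t₀, ContDiffAt ℝ 2 u (t, 0) := hl.eventually (hu.eventually (by simp))
    filter_upwards [e4, hr1.eventually hfn] with t h4 h5
    have hdS : HasFDerivAt S (fderiv ℝ S (t, 0)) (t, 0) :=
      (hS.differentiable (by simp) _).hasFDerivAt
    have hSd : fderiv ℝ S (t, 0) (0, 1) = t • w := by
      have h1 : HasDerivAt (fun s : ℝ => ((t, s) : ℝ × ℝ)) (0, 1) 0 :=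
        (hasDerivAt_const 0 t).prodMk (hasDerivAt_id 0)
      have h2 := hdS.comp_hasDerivAt (0 : ℝ) h1
      have h3 : HasDerivAt (fun s : ℝ => t • (v + s • w)) (t • w) 0 := by
        have h4 : HasDerivAt (fun s : ℝ => v + s • w) w 0 := by
          simpa using ((hasDerivAt_id (0 : ℝ)).smul_const w).const_add v
        exact h4.const_smul t
      exact h2.unique h3
    have hcf : HasFDerivAt c (fderiv ℝ f (t • v) ∘L fderiv ℝ S (t, 0)) (t, 0) :=
      HasFDerivAt.comp (t, 0) (g := f)
        (by rw [hS1]; exact (h5.differentiableAt (by simp)).hasFDerivAt) hdS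
    have hu1 : HasFDerivAt (fun x => (u x).1)
        ((ContinuousLinearMap.fst ℝ _ _) ∘L fderiv ℝ u (t, 0)) (t, 0) :=
      hasFDerivAt_fst.comp _ (h4.differentiableAt (by simp)).hasFDerivAt
    have heq := hu1.unique hcf
    have := congrArg (fun A : ℝ × ℝ →L[ℝ] EuclideanSpace ℝ (Fin d) => A (0, 1)) heq
    simp only [ContinuousLinearMap.comp_apply, hSd] at this
    exact this

/-- The inner product of two Jacobi fields along a radial line is analytic. It is the metric in
normal coordinates multiplied by `t²`. -/
lemma analyticAt_pullbackForm_normalMap_ray (hr : IsExpDiffeo d β.pt r)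
    {v : EuclideanSpace ℝ (Fin d)} (hv : v ∈ Metric.ball (0 : EuclideanSpace ℝ (Fin d)) r)
    (hv0 : v ≠ 0) {t₀ : ℝ} (ht₀ : t₀ • v ∈ Metric.ball (0 : EuclideanSpace ℝ (Fin d)) r)
    (w w' : EuclideanSpace ℝ (Fin d)) :
    AnalyticAt ℝ (fun t : ℝ => t ^ 2 * pullbackForm (normalMap β) (t • v) w w') t₀ := by
  set x₀ := normalMap β (t₀ • v) with hx
  have hx₀ : normalMap β (t₀ • v) ∈ (extChartAt (𝓡 d) x₀).source := mem_extChartAt_source _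
  obtain ⟨a1, a2⟩ := analyticAt_normalMap_ray hr hv hv0 ht₀ hx₀ w
  have a3 := (analyticAt_normalMap_ray hr hv hv0 ht₀ hx₀ w').2
  have hG : ContDiffAt ℝ ω (pullbackForm (extChartAt (𝓡 d) x₀).symm)
      (extChartAt (𝓡 d) x₀ (normalMap β (t₀ • v))) :=
    contDiffAt_pullbackForm_extChartAt_symm ((extChartAt (𝓡 d) x₀).map_source hx₀)
  have hG' : ContDiffAt ℝ ω (fun t : ℝ => pullbackForm (extChartAt (𝓡 d) x₀).symm
      (extChartAt (𝓡 d) x₀ (normalMap β (t • v)))) t₀ :=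
    ContDiffAt.comp t₀ (g := pullbackForm (extChartAt (𝓡 d) x₀).symm) hG a1.contDiffAt
  refine ((hG'.clm_apply a2.contDiffAt).clm_apply a3.contDiffAt).analyticAt.congr ?_
  have hcont : Continuous fun t : ℝ => t • v := by fun_prop
  have hb : ∀ᶠ t in 𝓝 t₀, t • v ∈ Metric.ball (0 : EuclideanSpace ℝ (Fin d)) r :=
    hcont.continuousAt.eventually_mem (Metric.isOpen_ball.mem_nhds ht₀)
  have hφ : ∀ y ∈ Metric.ball (0 : EuclideanSpace ℝ (Fin d)) r,
      ContMDiffAt (𝓡 d) (𝓡 d) ∞ (normalMap β) y := fun y hy =>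
    (contMDiffOn_normalMap hr).contMDiffAt (Metric.isOpen_ball.mem_nhds hy)
  have hs : ∀ᶠ t in 𝓝 t₀, normalMap β (t • v) ∈ (extChartAt (𝓡 d) x₀).source :=
    hcont.continuousAt.eventually (eventually_mem_chart_source (hφ _ ht₀).continuousAt hx₀)
  filter_upwards [hb, hs] with t h1 h2
  rw [pullbackForm_chart ((hφ _ h1).of_le ENat.LEInfty.out) h2]
  simp only [map_smul, _root_.smul_apply, smul_eq_mul]
  ring

end NormalMap

end RiemGeom

/-! ### The metric in normal coordinates and its Taylor series -/

namespace RiemGeom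
open Set Filter

section MetricSeries

variable {d : ℕ} {M : Type*} [MetricSpace M] [ChartedSpace (EuclideanSpace ℝ (Fin d)) M]
  [IsManifold (𝓡 d) ω M] [RiemannianBundle (fun x : M => TangentSpace (𝓡 d) x)]
  [IsContMDiffRiemannianBundle (𝓡 d) ω (EuclideanSpace ℝ (Fin d))
      (fun x : M => TangentSpace (𝓡 d) x)]
  {N : Type*} [MetricSpace N] [ChartedSpace (EuclideanSpace ℝ (Fin d)) N]
  [IsManifold (𝓡 d) ω N] [RiemannianBundle (fun x : N => TangentSpace (𝓡 d) x)]
  [IsContMDiffRiemannianBundle (𝓡 d) ω (EuclideanSpace ℝ (Fin d))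
      (fun x : N => TangentSpace (𝓡 d) x)]
  {β : Frame d M} {β' : Frame d N} {r r' : ℝ}

lemma contDiffOn_pullbackForm_normalMap (hr : IsExpDiffeo d β.pt r) :
    ContDiffOn ℝ ∞ (pullbackForm (normalMap β)) (Metric.ball 0 r) :=
  contDiffOn_pullbackForm Metric.isOpen_ball (contMDiffOn_normalMap hr) (by simp)

lemma contDiffOn_pullbackMetric_normalMap (hr : IsExpDiffeo d β.pt r) :
    ContDiffOn ℝ ∞ (pullbackMetric (normalMap β)) (Metric.ball 0 r) := by
  rw [contDiffOn_pi]
  intro i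
  rw [contDiffOn_pi]
  intro j
  exact ((contDiffOn_pullbackForm_normalMap hr).clm_apply contDiffOn_const).clm_apply
    contDiffOn_const

/-- The metric in normal coordinates is determined by its Taylor series at the origin: up to the
factor `t²` its restrictions to the lines through the origin are analytic. -/
theorem pullbackForm_normalMap_eq (hr : IsExpDiffeo d β.pt r) (hr' : IsExpDiffeo d β'.pt r')
    (hS : metricSeries β = metricSeries β') {v : EuclideanSpace ℝ (Fin d)}
    (hv : v ∈ Metric.ball (0 : EuclideanSpace ℝ (Fin d)) r)
    (hv' : v ∈ Metric.ball (0 : EuclideanSpace ℝ (Fin d)) r') :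
    pullbackForm (normalMap β) v = pullbackForm (normalMap β') v := by
  have hr0 : 0 < r := (norm_nonneg v).trans_lt (mem_ball_zero_iff.1 hv)
  have hr0' : 0 < r' := (norm_nonneg v).trans_lt (mem_ball_zero_iff.1 hv')
  have h0 : (0 : EuclideanSpace ℝ (Fin d)) ∈ Metric.ball (0 : EuclideanSpace ℝ (Fin d)) r :=
    Metric.mem_ball_self hr0
  have h0' : (0 : EuclideanSpace ℝ (Fin d)) ∈ Metric.ball (0 : EuclideanSpace ℝ (Fin d)) r' :=
    Metric.mem_ball_self hr0'
  have hder : ∀ n : ℕ, iteratedFDeriv ℝ n (pullbackMetric (normalMap β)) 0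
      = iteratedFDeriv ℝ n (pullbackMetric (normalMap β')) 0 := by
    intro n
    have := congrFun hS n
    simp only [metricSeries, taylorSeries] at this
    exact smul_right_injective _ (inv_ne_zero (Nat.cast_ne_zero.2 n.factorial_ne_zero)) this
  ext w w'
  -- evaluation of a matrix on the pair of vectors `w`, `w'`
  let Λ : (Fin d → Fin d → ℝ) →L[ℝ] ℝ := LinearMap.toContinuousLinearMap
    { toFun := fun A => ∑ i, ∑ j, w i * (w' j * A i j)
      map_add' := fun A B => by simp [mul_add, Finset.sum_add_distrib]
      map_smul' := fun c A => by
        simp only [Pi.smul_apply, smul_eq_mul, RingHom.id_apply, Finset.mul_sum]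
        exact Finset.sum_congr rfl fun i _ => Finset.sum_congr rfl fun j _ => by ring }
  have hΛ : ∀ y, pullbackForm (normalMap β) y w w' = Λ (pullbackMetric (normalMap β) y) :=
    fun y => pullbackForm_eq_sum _ y w w'
  have hΛ' : ∀ y, pullbackForm (normalMap β') y w w' = Λ (pullbackMetric (normalMap β') y) :=
    fun y => pullbackForm_eq_sum _ y w w'
  by_cases hv0 : v = 0
  · subst hv0
    have := congrArg (fun A => A (0 : Fin 0 → EuclideanSpace ℝ (Fin d))) (hder 0)
    simp only [iteratedFDeriv_zero_apply] at this
    rw [hΛ, hΛ', this]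
  let h : EuclideanSpace ℝ (Fin d) → Fin d → Fin d → ℝ :=
    pullbackMetric (normalMap β) - pullbackMetric (normalMap β')
  have hrr : ∀ y : EuclideanSpace ℝ (Fin d),
      y ∈ Metric.ball (0 : EuclideanSpace ℝ (Fin d)) (min r r')
      ↔ y ∈ Metric.ball (0 : EuclideanSpace ℝ (Fin d)) r ∧
        y ∈ Metric.ball (0 : EuclideanSpace ℝ (Fin d)) r' := fun y => by simp
  have hh : ContDiffOn ℝ ∞ h (Metric.ball 0 (min r r')) :=
    ((contDiffOn_pullbackMetric_normalMap hr).mono fun y hy => ((hrr y).1 hy).1).sub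
      ((contDiffOn_pullbackMetric_normalMap hr').mono fun y hy => ((hrr y).1 hy).2)
  have hball0 : Metric.ball (0 : EuclideanSpace ℝ (Fin d)) (min r r') ∈ 𝓝 0 :=
    Metric.ball_mem_nhds _ (lt_min hr0 hr0')
  have hflat : ∀ n : ℕ, iteratedFDeriv ℝ n (Λ ∘ h) 0 = 0 := by
    intro n
    have hn : ((n : ℕ∞) : WithTop ℕ∞) ≤ (∞ : WithTop ℕ∞) := by exact_mod_cast le_top
    have a1 : ContDiffAt ℝ n (pullbackMetric (normalMap β)) 0 :=
      ((contDiffOn_pullbackMetric_normalMap hr).contDiffAt (Metric.ball_mem_nhds _ hr0)).of_le hn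
    have a2 : ContDiffAt ℝ n (pullbackMetric (normalMap β')) 0 :=
      ((contDiffOn_pullbackMetric_normalMap hr').contDiffAt (Metric.ball_mem_nhds _ hr0')).of_le hn
    have hzero : iteratedFDeriv ℝ n h 0 = 0 := by
      rw [iteratedFDeriv_sub_apply a1 a2, hder, sub_self]
    rw [Λ.iteratedFDeriv_comp_left (hh.contDiffAt hball0) hn, hzero]
    ext
    simp
  have key : (Λ ∘ h) v = 0 := by
    refine eq_zero_of_flat_of_analyticAt (U := Metric.ball 0 (min r r')) Metric.isOpen_ball
      (Λ.contDiff.comp_contDiffOn hh) hflat (mem_of_mem_nhds hball0) ((hrr v).2 ⟨hv, hv'⟩) ?_ ?_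
    · exact (((convex_ball (0 : EuclideanSpace ℝ (Fin d)) (min r r')).is_linear_preimage
        (IsLinearMap.isLinearMap_smul' v))).isPreconnected
    · intro t ht
      obtain ⟨t1, t2⟩ := (hrr _).1 ht
      refine ((analyticAt_pullbackForm_normalMap_ray hr hv hv0 t1 w w').sub
        (analyticAt_pullbackForm_normalMap_ray hr' hv' hv0 t2 w w')).congr
        (Eventually.of_forall fun s => ?_)
      simp only [Pi.sub_apply, Function.comp_apply, h, map_sub, hΛ, hΛ']
      ring
  rw [hΛ, hΛ', ← sub_eq_zero, ← map_sub]
  exact key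

end MetricSeries

end RiemGeom

/-! ### The correspondence of normal coordinates on balls -/

namespace RiemGeom
open Set Filter Manifold

section Paths

variable {d : ℕ} {M : Type*} [MetricSpace M] [ChartedSpace (EuclideanSpace ℝ (Fin d)) M]
  [RiemannianBundle (fun x : M => TangentSpace (𝓡 d) x)] [IsRiemannianManifold (𝓡 d) M]

lemma edist_le_pathELength {γ : ℝ → M} {a b : ℝ} (hγ : ContMDiffOn 𝓘(ℝ, ℝ) (𝓡 d) 1 γ (Icc a b))
    (hab : a ≤ b) : edist (γ a) (γ b) ≤ pathELength (𝓡 d) γ a b := by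
  rw [IsRiemannianManifold.out (I := 𝓡 d) (γ a) (γ b)]
  exact riemannianEDist_le_pathELength hγ rfl rfl hab

/-- Points at distance less than `s` are joined by a `C¹` path of length less than `s`. -/
lemma exists_path_of_mem_ball {p q : M} {s : ℝ} (hq : q ∈ Metric.ball p s) :
    ∃ γ : ℝ → M, γ 0 = p ∧ γ 1 = q ∧ ContMDiff 𝓘(ℝ, ℝ) (𝓡 d) 1 γ ∧
      pathELength (𝓡 d) γ 0 1 < ENNReal.ofReal s := by
  have h : riemannianEDist (𝓡 d) p q < ENNReal.ofReal s := by
    rw [← IsRiemannianManifold.out (I := 𝓡 d) p q, edist_comm, edist_dist]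
    rw [Metric.mem_ball] at hq
    exact (ENNReal.ofReal_lt_ofReal_iff (dist_nonneg.trans_lt hq)).2 hq
  obtain ⟨γ, h0, h1, hγ, hl, -, -⟩ :=
    exists_lt_locally_constant_of_riemannianEDist_lt h zero_lt_one
  exact ⟨γ, h0, h1, hγ, hl⟩

lemma mem_ball_of_edist_le {p q : M} {s : ℝ} {ℓ : ℝ≥0∞} (h : edist p q ≤ ℓ)
    (hℓ : ℓ < ENNReal.ofReal s) : q ∈ Metric.ball p s := by
  have h1 := h.trans_lt hℓ
  rw [edist_dist] at h1
  rw [Metric.mem_ball, dist_comm]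
  by_contra hs
  exact absurd h1 (not_lt.2 (ENNReal.ofReal_le_ofReal (not_lt.1 hs)))

lemma path_mem_ball_left {γ : ℝ → M} {s : ℝ} (hγ : ContMDiff 𝓘(ℝ, ℝ) (𝓡 d) 1 γ)
    (hl : pathELength (𝓡 d) γ 0 1 < ENNReal.ofReal s) {t : ℝ} (ht : t ∈ Icc (0 : ℝ) 1) :
    γ t ∈ Metric.ball (γ 0) s :=
  mem_ball_of_edist_le ((edist_le_pathELength hγ.contMDiffOn ht.1).trans
    (pathELength_mono le_rfl ht.2)) hl

lemma path_mem_ball_right {γ : ℝ → M} {s : ℝ} (hγ : ContMDiff 𝓘(ℝ, ℝ) (𝓡 d) 1 γ)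
    (hl : pathELength (𝓡 d) γ 0 1 < ENNReal.ofReal s) {t : ℝ} (ht : t ∈ Icc (0 : ℝ) 1) :
    γ t ∈ Metric.ball (γ 1) s := by
  refine mem_ball_of_edist_le ?_ hl
  rw [edist_comm]
  exact (edist_le_pathELength hγ.contMDiffOn ht.2).trans (pathELength_mono ht.1 le_rfl)

end Paths

section Correspondence

variable {d : ℕ} {M : Type*} [MetricSpace M] [ChartedSpace (EuclideanSpace ℝ (Fin d)) M]
  [RiemannianBundle (fun x : M => TangentSpace (𝓡 d) x)]
  {N : Type*} [MetricSpace N] [ChartedSpace (EuclideanSpace ℝ (Fin d)) N]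
  [RiemannianBundle (fun x : N => TangentSpace (𝓡 d) x)]
  {β : Frame d M} {β' : Frame d N} {r r' : ℝ}

/-- The set of points in the domain of the normal coordinates of `β` whose coordinates also belong
to the ball of radius `r'`. -/
def commonDomain (β : Frame d M) (r r' : ℝ) : Set M :=
  Metric.ball β.pt r ∩ normalCoord β ⁻¹' Metric.ball 0 r'

lemma contMDiffAt_normalCorrespondence (hr0 : 0 < r) (hr : IsExpDiffeo d β.pt r)
    (hr' : IsExpDiffeo d β'.pt r') {q : M} (hq : q ∈ commonDomain β r r') :
    ContMDiffAt (𝓡 d) (𝓡 d) ∞ (normalCorrespondence β β') q :=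
  ((contMDiffOn_normalMap hr').contMDiffAt (Metric.isOpen_ball.mem_nhds hq.2)).comp q
    ((contMDiffOn_normalCoord hr0 hr).contMDiffAt (Metric.isOpen_ball.mem_nhds hq.1))

lemma normalCorrespondence_normalMap (hr0 : 0 < r) (hr : IsExpDiffeo d β.pt r)
    {x : EuclideanSpace ℝ (Fin d)} (hx : x ∈ Metric.ball (0 : EuclideanSpace ℝ (Fin d)) r) :
    normalCorrespondence β β' (normalMap β x) = normalMap β' x := by
  rw [normalCorrespondence, Function.comp_apply, normalCoord_normalMap hr0 hr hx]

/-- Where the metrics agree in normal coordinates, the correspondence of normal coordinates is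
isometric. -/
lemma inner_mfderiv_normalCorrespondence (hr0 : 0 < r) (hr : IsExpDiffeo d β.pt r)
    (hr' : IsExpDiffeo d β'.pt r')
    (hmetric : ∀ x ∈ Metric.ball (0 : EuclideanSpace ℝ (Fin d)) r,
      x ∈ Metric.ball (0 : EuclideanSpace ℝ (Fin d)) r' →
        pullbackForm (normalMap β) x = pullbackForm (normalMap β') x)
    {q : M} (hq : q ∈ commonDomain β r r') (v w : TangentSpace (𝓡 d) q) :
    inner ℝ (mfderiv (𝓡 d) (𝓡 d) (normalCorrespondence β β') q v :
        TangentSpace (𝓡 d) (normalCorrespondence β β' q))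
      (mfderiv (𝓡 d) (𝓡 d) (normalCorrespondence β β') q w :
        TangentSpace (𝓡 d) (normalCorrespondence β β' q)) = inner ℝ v w := by
  have hf := (contMDiffAt_normalCorrespondence hr0 hr hr' hq).mdifferentiableAt (by simp)
  have hx := normalCoord_mem_ball hr0 hr hq.1
  have hx' : normalCoord β q ∈ Metric.ball (0 : EuclideanSpace ℝ (Fin d)) r' := hq.2
  obtain ⟨x, hxq⟩ : ∃ x, x = normalCoord β q := ⟨_, rfl⟩
  have hqx : q = normalMap β x := by rw [hxq, normalMap_normalCoord hr0 hr hq.1]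
  rw [← hxq] at hx hx'
  subst hqx
  have hφ : MDifferentiableAt (𝓡 d) (𝓡 d) (normalMap β) x :=
    ((contMDiffOn_normalMap hr).contMDiffAt (Metric.isOpen_ball.mem_nhds hx)).mdifferentiableAt
      (by simp)
  have hsurj : Function.Surjective (mfderiv (𝓡 d) (𝓡 d) (normalMap β) x) := by
    let A : EuclideanSpace ℝ (Fin d) →L[ℝ] EuclideanSpace ℝ (Fin d) :=
      mfderiv (𝓡 d) (𝓡 d) (normalMap β) x
    exact (LinearMap.injective_iff_surjective
      (f := (A : EuclideanSpace ℝ (Fin d) →ₗ[ℝ] EuclideanSpace ℝ (Fin d)))).1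
      (injective_mfderiv_normalMap hr0 hr hx)
  obtain ⟨u, rfl⟩ : ∃ u : EuclideanSpace ℝ (Fin d),
      mfderiv (𝓡 d) (𝓡 d) (normalMap β) x u = v := hsurj v
  obtain ⟨z, rfl⟩ : ∃ z : EuclideanSpace ℝ (Fin d),
      mfderiv (𝓡 d) (𝓡 d) (normalMap β) x z = w := hsurj w
  have hloc : normalCorrespondence β β' ∘ normalMap β =ᶠ[𝓝 x] normalMap β' := by
    filter_upwards [Metric.isOpen_ball.mem_nhds hx] with y hy
    exact normalCorrespondence_normalMap hr0 hr hy
  have h1 : pullbackForm (normalCorrespondence β β' ∘ normalMap β) x u z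
      = pullbackForm (normalMap β) x u z := by
    rw [pullbackForm_congr hloc, hmetric x hx hx']
  rw [pullbackForm_apply, pullbackForm_apply, mfderiv_comp x hf hφ] at h1
  exact h1

lemma enorm_mfderiv_normalCorrespondence (hr0 : 0 < r) (hr : IsExpDiffeo d β.pt r)
    (hr' : IsExpDiffeo d β'.pt r')
    (hmetric : ∀ x ∈ Metric.ball (0 : EuclideanSpace ℝ (Fin d)) r,
      x ∈ Metric.ball (0 : EuclideanSpace ℝ (Fin d)) r' →
        pullbackForm (normalMap β) x = pullbackForm (normalMap β') x)
    {q : M} (hq : q ∈ commonDomain β r r') (v : TangentSpace (𝓡 d) q) :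
    ‖(mfderiv (𝓡 d) (𝓡 d) (normalCorrespondence β β') q v :
        TangentSpace (𝓡 d) (normalCorrespondence β β' q))‖ₑ = ‖v‖ₑ := by
  rw [enorm_eq_iff_norm_eq, norm_eq_sqrt_real_inner (F := TangentSpace (𝓡 d) q),
    norm_eq_sqrt_real_inner (F := TangentSpace (𝓡 d) (normalCorrespondence β β' q)),
    inner_mfderiv_normalCorrespondence hr0 hr hr' hmetric hq]

section Length

variable [IsRiemannianManifold (𝓡 d) N]

/-- The image of a path in the common domain has the same length, which bounds the distance of its
end points. -/
lemma edist_normalCorrespondence_le_pathELength (hr0 : 0 < r) (hr : IsExpDiffeo d β.pt r)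
    (hr' : IsExpDiffeo d β'.pt r')
    (hmetric : ∀ x ∈ Metric.ball (0 : EuclideanSpace ℝ (Fin d)) r,
      x ∈ Metric.ball (0 : EuclideanSpace ℝ (Fin d)) r' →
        pullbackForm (normalMap β) x = pullbackForm (normalMap β') x)
    {γ : ℝ → M} (hγ : ContMDiff 𝓘(ℝ, ℝ) (𝓡 d) 1 γ) {a b : ℝ} (hab : a ≤ b)
    (hO : ∀ t ∈ Icc a b, γ t ∈ commonDomain β r r') :
    edist (normalCorrespondence β β' (γ a)) (normalCorrespondence β β' (γ b))
      ≤ pathELength (𝓡 d) γ a b := by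
  have hf : ∀ t ∈ Icc a b, ContMDiffAt (𝓡 d) (𝓡 d) 1 (normalCorrespondence β β') (γ t) :=
    fun t ht => (contMDiffAt_normalCorrespondence hr0 hr hr' (hO t ht)).of_le ENat.LEInfty.out
  have hsmooth : ContMDiffOn 𝓘(ℝ, ℝ) (𝓡 d) 1 (normalCorrespondence β β' ∘ γ) (Icc a b) :=
    fun t ht => ((hf t ht).comp t hγ.contMDiffAt).contMDiffWithinAt
  refine (edist_le_pathELength (γ := normalCorrespondence β β' ∘ γ) hsmooth hab).trans_eq ?_
  rw [pathELength_eq_lintegral_mfderiv_Icc, pathELength_eq_lintegral_mfderiv_Icc]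
  refine MeasureTheory.setLIntegral_congr_fun measurableSet_Icc fun t ht => ?_
  rw [mfderiv_comp t ((hf t ht).mdifferentiableAt (by simp))
    (hγ.mdifferentiable (by simp) t)]
  exact enorm_mfderiv_normalCorrespondence hr0 hr hr' hmetric (hO t ht) _

end Length

variable [IsManifold (𝓡 d) ω M] [IsContMDiffRiemannianBundle (𝓡 d) ω (EuclideanSpace ℝ (Fin d))
      (fun x : M => TangentSpace (𝓡 d) x)]
  [IsManifold (𝓡 d) ω N] [IsContMDiffRiemannianBundle (𝓡 d) ω (EuclideanSpace ℝ (Fin d))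
      (fun x : N => TangentSpace (𝓡 d) x)]

lemma normalCoord_pt (hr0 : 0 < r) (hr : IsExpDiffeo d β.pt r) : normalCoord β β.pt = 0 := by
  have := normalCoord_normalMap hr0 hr (Metric.mem_ball_self hr0)
  rwa [normalMap_zero] at this

lemma normalCorrespondence_pt (hr0 : 0 < r) (hr : IsExpDiffeo d β.pt r) :
    normalCorrespondence β β' β.pt = β'.pt := by
  rw [normalCorrespondence, Function.comp_apply, normalCoord_pt hr0 hr, normalMap_zero]

variable [IsRiemannianManifold (𝓡 d) M] [IsRiemannianManifold (𝓡 d) N]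

/-- A short path issued from the base point stays in the common domain. At the first exit time the
image path, which has the same length, converges by completeness to a point of the ball of radius
`r'` around the base point of `β'`, and its normal coordinates are those of the exit point. -/
lemma path_mem_commonDomain [CompleteSpace N] (hr0 : 0 < r) (hr0' : 0 < r')
    (hr : IsExpDiffeo d β.pt r) (hr' : IsExpDiffeo d β'.pt r')
    (hmetric : ∀ x ∈ Metric.ball (0 : EuclideanSpace ℝ (Fin d)) r,
      x ∈ Metric.ball (0 : EuclideanSpace ℝ (Fin d)) r' →
        pullbackForm (normalMap β) x = pullbackForm (normalMap β') x)
    {γ : ℝ → M} (hγ : ContMDiff 𝓘(ℝ, ℝ) (𝓡 d) 1 γ) (h0 : γ 0 = β.pt)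
    (hl : pathELength (𝓡 d) γ 0 1 < ENNReal.ofReal r)
    (hl' : pathELength (𝓡 d) γ 0 1 < ENNReal.ofReal r') {t : ℝ} (ht : t ∈ Icc (0 : ℝ) 1) :
    γ t ∈ commonDomain β r r' := by
  have hball : ∀ t ∈ Icc (0 : ℝ) 1, γ t ∈ Metric.ball β.pt r := fun t ht => by
    rw [← h0]; exact path_mem_ball_left hγ hl ht
  let x : ℝ → EuclideanSpace ℝ (Fin d) := fun t => normalCoord β (γ t)
  have hx : ContinuousOn x (Icc 0 1) :=
    (contMDiffOn_normalCoord hr0 hr).continuousOn.comp hγ.continuous.continuousOn hball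
  by_contra hcon
  let B : Set ℝ := Icc (0 : ℝ) 1 ∩ x ⁻¹' (Metric.ball 0 r')ᶜ
  have hBc : IsClosed B := hx.preimage_isClosed_of_isClosed isClosed_Icc
    Metric.isOpen_ball.isClosed_compl
  have hBn : B.Nonempty := ⟨t, ht, fun h => hcon ⟨hball t ht, h⟩⟩
  have hBb : BddBelow B := ⟨0, fun s hs => hs.1.1⟩
  let t₀ := sInf B
  have ht₀ : t₀ ∈ B := hBc.csInf_mem hBn hBb
  have hlt : ∀ s, 0 ≤ s → s < t₀ → γ s ∈ commonDomain β r r' := by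
    intro s hs hst
    have hs1 : s ∈ Icc (0 : ℝ) 1 := ⟨hs, hst.le.trans ht₀.1.2⟩
    refine ⟨hball s hs1, ?_⟩
    by_contra h
    exact absurd (csInf_le hBb (⟨hs1, h⟩ : s ∈ B)) (not_le.2 hst)
  have hpos : 0 < t₀ := by
    refine lt_of_le_of_ne ht₀.1.1 fun h => ht₀.2 ?_
    rw [← h]
    simp only [x, h0, normalCoord_pt hr0 hr]
    exact Metric.mem_ball_self hr0'
  -- times increasing to the first exit time, at which the image path is a Cauchy sequence
  obtain ⟨τ, hτm, hτ, hτt⟩ := exists_seq_strictMono_tendsto' hpos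
  let ℓ := pathELength (𝓡 d) γ 0 1
  have hfin : ℓ ≠ ⊤ := (hl.trans_le le_top).ne
  have hle : ∀ n, pathELength (𝓡 d) γ 0 (τ n) ≤ ℓ := fun n =>
    pathELength_mono le_rfl ((hτ n).2.le.trans ht₀.1.2)
  have hfinn : ∀ n, pathELength (𝓡 d) γ 0 (τ n) ≠ ⊤ := fun n => ne_top_of_le_ne_top hfin (hle n)
  let L : ℕ → ℝ := fun n => (pathELength (𝓡 d) γ 0 (τ n)).toReal
  have hLm : Monotone L := fun m n hmn =>
    ENNReal.toReal_mono (hfinn n) (pathELength_mono le_rfl (hτm.monotone hmn))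
  have hLb : BddAbove (range L) := by
    refine ⟨ℓ.toReal, ?_⟩
    rintro _ ⟨n, rfl⟩
    exact ENNReal.toReal_mono hfin (hle n)
  have hLc : CauchySeq L := (tendsto_atTop_ciSup hLm hLb).cauchySeq
  let y : ℕ → N := fun n => normalCorrespondence β β' (γ (τ n))
  have hdist : ∀ m n, m ≤ n → dist (y m) (y n) ≤ L n - L m := by
    intro m n hmn
    have h1 := edist_normalCorrespondence_le_pathELength hr0 hr hr' hmetric hγ
      (hτm.monotone hmn) (fun s hs => hlt s ((hτ m).1.le.trans hs.1) (hs.2.trans_lt (hτ n).2))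
    have h2 := pathELength_add (I := 𝓡 d) (γ := γ) (hτ m).1.le (hτm.monotone hmn)
    have h3 : pathELength (𝓡 d) γ (τ m) (τ n) ≠ ⊤ :=
      ne_top_of_le_ne_top (hfinn n) (h2 ▸ le_add_self)
    have h4 : L m + (pathELength (𝓡 d) γ (τ m) (τ n)).toReal = L n := by
      simp only [L]
      rw [← h2, ENNReal.toReal_add (hfinn m) h3]
    have h5 := ENNReal.toReal_mono h3 h1
    rw [edist_dist, ENNReal.toReal_ofReal dist_nonneg] at h5
    simp only [y]
    linarith
  have hyc : CauchySeq y := by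
    rw [Metric.cauchySeq_iff'] at hLc ⊢
    intro ε hε
    obtain ⟨n₀, hn₀⟩ := hLc ε hε
    refine ⟨n₀, fun n hn => ?_⟩
    rw [dist_comm]
    refine (hdist n₀ n hn).trans_lt (lt_of_le_of_lt (le_abs_self _) ?_)
    rw [← Real.dist_eq]
    exact hn₀ n hn
  obtain ⟨z, hz⟩ := cauchySeq_tendsto_of_complete hyc
  have hzball : z ∈ Metric.ball β'.pt r' := by
    refine mem_ball_of_edist_le (ℓ := ℓ) ?_ hl'
    refine le_of_tendsto (tendsto_const_nhds.edist hz) (Eventually.of_forall fun n => ?_)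
    have h1 := edist_normalCorrespondence_le_pathELength hr0 hr hr' hmetric hγ
      (hτ n).1.le (fun s hs => hlt s hs.1 (hs.2.trans_lt (hτ n).2))
    rw [h0, normalCorrespondence_pt hr0 hr] at h1
    exact h1.trans (hle n)
  have hcoord : Tendsto (fun n => normalCoord β' (y n)) atTop (𝓝 (normalCoord β' z)) :=
    (((contMDiffOn_normalCoord hr0' hr').continuousOn.continuousAt
      (Metric.isOpen_ball.mem_nhds hzball)).tendsto).comp hz
  have hxt : Tendsto (fun n => x (τ n)) atTop (𝓝 (x t₀)) := by
    refine (hx t₀ ht₀.1).tendsto.comp (tendsto_nhdsWithin_iff.2 ⟨hτt, Eventually.of_forall ?_⟩)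
    exact fun n => ⟨(hτ n).1.le, (hτ n).2.le.trans ht₀.1.2⟩
  have heq : (fun n => normalCoord β' (y n)) = fun n => x (τ n) := by
    funext n
    exact normalCoord_normalMap hr0' hr' (hlt (τ n) (hτ n).1.le (hτ n).2).2
  rw [heq] at hcoord
  have hmem : x t₀ ∈ Metric.ball (0 : EuclideanSpace ℝ (Fin d)) r' := by
    rw [tendsto_nhds_unique hxt hcoord]
    exact normalCoord_mem_ball hr0' hr' hzball
  exact ht₀.2 hmem

variable {s : ℝ}

/-- A ball around the base point of radius at most `r` and `r'` lies in the common domain, because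
its points are reached by short paths. This replaces an appeal to the Gauss lemma. -/
lemma ball_subset_commonDomain [CompleteSpace N] (hr0 : 0 < r) (hr0' : 0 < r')
    (hr : IsExpDiffeo d β.pt r) (hr' : IsExpDiffeo d β'.pt r')
    (hmetric : ∀ x ∈ Metric.ball (0 : EuclideanSpace ℝ (Fin d)) r,
      x ∈ Metric.ball (0 : EuclideanSpace ℝ (Fin d)) r' →
        pullbackForm (normalMap β) x = pullbackForm (normalMap β') x)
    (hs : s ≤ r) (hs' : s ≤ r') : Metric.ball β.pt s ⊆ commonDomain β r r' := by
  intro q hq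
  obtain ⟨γ, h0, h1, hγ, hl⟩ := exists_path_of_mem_ball (d := d) hq
  rw [← h1]
  exact path_mem_commonDomain hr0 hr0' hr hr' hmetric hγ h0
    (hl.trans_le (ENNReal.ofReal_le_ofReal hs)) (hl.trans_le (ENNReal.ofReal_le_ofReal hs'))
    ⟨zero_le_one, le_rfl⟩

lemma mapsTo_normalCorrespondence_ball [CompleteSpace N] (hr0 : 0 < r) (hr0' : 0 < r')
    (hr : IsExpDiffeo d β.pt r) (hr' : IsExpDiffeo d β'.pt r')
    (hmetric : ∀ x ∈ Metric.ball (0 : EuclideanSpace ℝ (Fin d)) r,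
      x ∈ Metric.ball (0 : EuclideanSpace ℝ (Fin d)) r' →
        pullbackForm (normalMap β) x = pullbackForm (normalMap β') x)
    (hs : s ≤ r) (hs' : s ≤ r') :
    MapsTo (normalCorrespondence β β') (Metric.ball β.pt s) (Metric.ball β'.pt s) := by
  intro q hq
  obtain ⟨γ, h0, h1, hγ, hl⟩ := exists_path_of_mem_ball (d := d) hq
  have h := edist_normalCorrespondence_le_pathELength hr0 hr hr' hmetric hγ zero_le_one
    fun t ht => path_mem_commonDomain hr0 hr0' hr hr' hmetric hγ h0
      (hl.trans_le (ENNReal.ofReal_le_ofReal hs)) (hl.trans_le (ENNReal.ofReal_le_ofReal hs')) ht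
  rw [h0, h1, normalCorrespondence_pt hr0 hr] at h
  exact mem_ball_of_edist_le h hl

/-- The correspondence of normal coordinates maps balls onto balls: neither it nor its inverse, the
correspondence in the opposite direction, increases the distance to the base point. -/
theorem image_normalCorrespondence_ball [CompleteSpace M] [CompleteSpace N]
    (hr0 : 0 < r) (hr0' : 0 < r')
    (hr : IsExpDiffeo d β.pt r) (hr' : IsExpDiffeo d β'.pt r')
    (hmetric : ∀ x ∈ Metric.ball (0 : EuclideanSpace ℝ (Fin d)) r,
      x ∈ Metric.ball (0 : EuclideanSpace ℝ (Fin d)) r' →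
        pullbackForm (normalMap β) x = pullbackForm (normalMap β') x)
    (hs : s ≤ r) (hs' : s ≤ r') :
    normalCorrespondence β β' '' Metric.ball β.pt s = Metric.ball β'.pt s := by
  refine (mapsTo_normalCorrespondence_ball hr0 hr0' hr hr' hmetric hs hs').image_subset.antisymm ?_
  intro q hq
  have hmetric' : ∀ x ∈ Metric.ball (0 : EuclideanSpace ℝ (Fin d)) r',
      x ∈ Metric.ball (0 : EuclideanSpace ℝ (Fin d)) r →
        pullbackForm (normalMap β') x = pullbackForm (normalMap β) x :=
    fun x hx hx' => (hmetric x hx' hx).symm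
  refine ⟨normalCorrespondence β' β q,
    mapsTo_normalCorrespondence_ball hr0' hr0 hr' hr hmetric' hs' hs hq, ?_⟩
  have hq' := ball_subset_commonDomain hr0' hr0 hr' hr hmetric' hs' hs hq
  have he : normalCorrespondence β' β q = normalMap β (normalCoord β' q) := rfl
  rw [he, normalCorrespondence_normalMap hr0 hr hq'.2, normalMap_normalCoord hr0' hr' hq'.1]

end Correspondence

end RiemGeom

/-! ### Agreement on overlaps -/

namespace RiemGeom
open Set Filter Manifold

section Rigidity

variable {d : ℕ} {N : Type*} [MetricSpace N] [ChartedSpace (EuclideanSpace ℝ (Fin d)) N]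
  [IsManifold (𝓡 d) ω N] [RiemannianBundle (fun x : N => TangentSpace (𝓡 d) x)]
  [IsContMDiffRiemannianBundle (𝓡 d) ω (EuclideanSpace ℝ (Fin d))
      (fun x : N => TangentSpace (𝓡 d) x)]
  {F₁ F₂ : EuclideanSpace ℝ (Fin d) → N}

/-- Two maps pulling back the metric of `N` to the same metric coincide near a point at which
their 1-jets agree. -/
lemma eventuallyEq_of_pullbackForm_eq {x : EuclideanSpace ℝ (Fin d)} {z₀ : N}
    (h₁ : ContMDiffAt (𝓡 d) (𝓡 d) ∞ F₁ x) (h₂ : ContMDiffAt (𝓡 d) (𝓡 d) ∞ F₂ x)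
    (hinj : Function.Injective (mfderiv (𝓡 d) (𝓡 d) F₁ x))
    (hp : ∀ᶠ y in 𝓝 x, pullbackForm F₁ y = pullbackForm F₂ y) (h0 : F₁ x = F₂ x)
    (hz : F₁ x ∈ (extChartAt (𝓡 d) z₀).source)
    (hd : fderiv ℝ (fun y => extChartAt (𝓡 d) z₀ (F₁ y)) x
      = fderiv ℝ (fun y => extChartAt (𝓡 d) z₀ (F₂ y)) x) : F₁ =ᶠ[𝓝 x] F₂ := by
  have hz₂ : F₂ x ∈ (extChartAt (𝓡 d) z₀).source := h0 ▸ hz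
  have ht : extChartAt (𝓡 d) z₀ (F₁ x) ∈ (extChartAt (𝓡 d) z₀).target :=
    (extChartAt (𝓡 d) z₀).map_source hz
  have s₁ := eventually_mem_chart_source h₁.continuousAt hz
  have s₂ := eventually_mem_chart_source h₂.continuousAt hz₂
  -- `C^∞` at a point only gives `C^n` nearby for finite `n`
  have smooth : ∀ {F : EuclideanSpace ℝ (Fin d) → N}, ContMDiffAt (𝓡 d) (𝓡 d) ∞ F x →
      ∀ᶠ y in 𝓝 x, ContMDiffAt (𝓡 d) (𝓡 d) 1 F y := fun hF =>
    (contMDiffAt_iff_contMDiffAt_nhds (by simp)).1 (hF.of_le ENat.LEInfty.out)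
  have key := MetricRigidity.eventuallyEq_of_pullForm_eq
    (F₁ := fun y => extChartAt (𝓡 d) z₀ (F₁ y)) (F₂ := fun y => extChartAt (𝓡 d) z₀ (F₂ y))
    (H := pullbackForm (extChartAt (𝓡 d) z₀).symm) (x := x)
    ((contDiffAt_extChartAt_comp h₁ hz).of_le ENat.LEInfty.out)
    ((contDiffAt_extChartAt_comp h₂ hz₂).of_le ENat.LEInfty.out)
    ((contDiffAt_pullbackForm_extChartAt_symm ht).of_le le_top)
    (Eventually.of_forall fun z a b => pullbackForm_comm _ z a b)
    (fun a ha => eq_zero_of_pullbackForm_self (injective_mfderiv_extChartAt_symm ht) (ha a))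
    (by
      rw [injective_iff_map_eq_zero]
      intro u hu
      refine eq_zero_of_pullbackForm_self hinj ?_
      rw [pullbackForm_chart (h₁.of_le ENat.LEInfty.out) hz, hu, map_zero])
    (by
      filter_upwards [hp, s₁, s₂, smooth h₁, smooth h₂] with y y1 y2 y3 y4 y5 a b
      rw [← pullbackForm_chart y4 y2, ← pullbackForm_chart y5 y3, y1])
    (by simp only [h0]) hd
  filter_upwards [key, s₁, s₂] with y y1 y2 y3
  exact (extChartAt (𝓡 d) z₀).injOn y2 y3 y1

/-- Two maps pulling back the metric of `N` to the same metric and agreeing near the starting point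
of a path agree at its end point: the 1-jets agree on the closure of the set of points near which
the maps agree, so this set is relatively closed. -/
lemma eq_of_pullbackForm_eq_of_path {U : Set (EuclideanSpace ℝ (Fin d))} (hU : IsOpen U)
    (h₁ : ContMDiffOn (𝓡 d) (𝓡 d) ∞ F₁ U) (h₂ : ContMDiffOn (𝓡 d) (𝓡 d) ∞ F₂ U)
    (hinj : ∀ x ∈ U, Function.Injective (mfderiv (𝓡 d) (𝓡 d) F₁ x))
    (hp : ∀ x ∈ U, pullbackForm F₁ x = pullbackForm F₂ x)
    {c : ℝ → EuclideanSpace ℝ (Fin d)} (hc : ContinuousOn c (Icc 0 1))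
    (hcU : ∀ t ∈ Icc (0 : ℝ) 1, c t ∈ U) (hstart : F₁ =ᶠ[𝓝 (c 0)] F₂) : F₁ (c 1) = F₂ (c 1) := by
  have hsub : c '' Icc 0 1 ⊆ {x | F₁ =ᶠ[𝓝 x] F₂} := by
    refine (isPreconnected_Icc.image c hc).subset_of_closure_inter_subset
      isOpen_setOfPred_eventually_nhds ⟨c 0, ⟨0, ⟨le_rfl, zero_le_one⟩, rfl⟩, hstart⟩ ?_
    rintro x ⟨hx, ⟨t, ht, rfl⟩⟩
    have hxU := hcU t ht
    have hfr : ∃ᶠ y in 𝓝 (c t), F₁ =ᶠ[𝓝 y] F₂ := mem_closure_iff_frequently.1 hx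
    have m₁ := h₁.contMDiffAt (hU.mem_nhds hxU)
    have m₂ := h₂.contMDiffAt (hU.mem_nhds hxU)
    have h0 : F₁ (c t) = F₂ (c t) := tendsto_nhds_unique_of_frequently_eq m₁.continuousAt
      m₂.continuousAt (hfr.mono fun y hy => hy.self_of_nhds)
    have hz : F₁ (c t) ∈ (extChartAt (𝓡 d) (F₁ (c t))).source := mem_extChartAt_source _
    have d₁ := ((contDiffAt_extChartAt_comp m₁ hz).fderiv_right (m := 0)
      (by simp)).continuousAt
    have d₂ := ((contDiffAt_extChartAt_comp (x₀ := F₁ (c t)) m₂ (h0 ▸ hz)).fderiv_right (m := 0)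
      (by simp)).continuousAt
    refine eventuallyEq_of_pullbackForm_eq m₁ m₂ (hinj _ hxU)
      (by filter_upwards [hU.mem_nhds hxU] with y hy using hp y hy) h0 hz ?_
    refine tendsto_nhds_unique_of_frequently_eq d₁ d₂ (hfr.mono fun y hy => ?_)
    exact (hy.fun_comp (extChartAt (𝓡 d) (F₁ (c t)))).fderiv_eq
  have := hsub ⟨1, ⟨zero_le_one, le_rfl⟩, rfl⟩
  exact Eventually.self_of_nhds (p := fun y => F₁ y = F₂ y) this

end Rigidity

section Overlap

variable {d : ℕ} {M : Type*} [MetricSpace M] [ChartedSpace (EuclideanSpace ℝ (Fin d)) M]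
  [IsManifold (𝓡 d) ω M] [RiemannianBundle (fun x : M => TangentSpace (𝓡 d) x)]
  [IsContMDiffRiemannianBundle (𝓡 d) ω (EuclideanSpace ℝ (Fin d))
      (fun x : M => TangentSpace (𝓡 d) x)]

lemma contDiffAt_transition {β₁ β₂ : Frame d M} {r₁ r₂ : ℝ} (hr₁0 : 0 < r₁) (hr₂0 : 0 < r₂)
    (hr₁ : IsExpDiffeo d β₁.pt r₁) (hr₂ : IsExpDiffeo d β₂.pt r₂)
    (hp : β₂.pt ∈ Metric.ball β₁.pt r₁) :
    ContDiffAt ℝ ∞ (normalCoord β₁ ∘ normalMap β₂) 0 := by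
  rw [← normalMap_zero β₂] at hp
  exact ContMDiffAt.contDiffAt (((contMDiffOn_normalCoord hr₁0 hr₁).contMDiffAt
    (Metric.isOpen_ball.mem_nhds hp)).comp 0
    ((contMDiffOn_normalMap hr₂).contMDiffAt (Metric.ball_mem_nhds 0 hr₂0)))

variable {N : Type*} [MetricSpace N] [ChartedSpace (EuclideanSpace ℝ (Fin d)) N]
  [IsManifold (𝓡 d) ω N] [RiemannianBundle (fun x : N => TangentSpace (𝓡 d) x)]
  [IsContMDiffRiemannianBundle (𝓡 d) ω (EuclideanSpace ℝ (Fin d))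
      (fun x : N => TangentSpace (𝓡 d) x)]
  {β₁ β₂ : Frame d M} {β₁' β₂' : Frame d N} {r₁ r₂ r₁' r₂' δ : ℝ}

/-- If the transition maps have the same 1-jet at the origin, the two correspondences of normal
coordinates agree near the base point of the second frame. -/
lemma normalCorrespondence_comp_normalMap_eventuallyEq
    (hr₁0 : 0 < r₁) (hr₂0 : 0 < r₂) (hr₁0' : 0 < r₁') (hr₂0' : 0 < r₂')
    (hr₁ : IsExpDiffeo d β₁.pt r₁) (hr₂ : IsExpDiffeo d β₂.pt r₂)
    (hr₁' : IsExpDiffeo d β₁'.pt r₁') (hr₂' : IsExpDiffeo d β₂'.pt r₂')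
    (hp : β₂.pt ∈ Metric.ball β₁.pt r₁) (hp' : β₂'.pt ∈ Metric.ball β₁'.pt r₁')
    (hT : transitionSeries β₁ β₂ = transitionSeries β₁' β₂')
    (hform : ∀ᶠ y in 𝓝 (0 : EuclideanSpace ℝ (Fin d)), pullbackForm (normalMap β₂') y
      = pullbackForm (normalCorrespondence β₁ β₁' ∘ normalMap β₂) y) :
    normalMap β₂' =ᶠ[𝓝 0] normalCorrespondence β₁ β₁' ∘ normalMap β₂ := by
  set τ := normalCoord β₁ ∘ normalMap β₂ with hτ
  set τ' := normalCoord β₁' ∘ normalMap β₂' with hτ'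
  have cτ : ContDiffAt ℝ ∞ τ 0 := contDiffAt_transition hr₁0 hr₂0 hr₁ hr₂ hp
  have cτ' : ContDiffAt ℝ ∞ τ' 0 := contDiffAt_transition hr₁0' hr₂0' hr₁' hr₂' hp'
  have hder : ∀ n : ℕ, iteratedFDeriv ℝ n τ 0 = iteratedFDeriv ℝ n τ' 0 := by
    intro n
    have := congrFun hT n
    simp only [transitionSeries, taylorSeries] at this
    exact smul_right_injective _ (inv_ne_zero (Nat.cast_ne_zero.2 n.factorial_ne_zero)) this
  have e0 : τ 0 = τ' 0 := by
    have := congrArg (fun A => A (0 : Fin 0 → EuclideanSpace ℝ (Fin d))) (hder 0)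
    simpa only [iteratedFDeriv_zero_apply] using this
  have e1 : fderiv ℝ τ 0 = fderiv ℝ τ' 0 := by
    ext1 u
    have := congrArg (fun A => A (fun _ => u : Fin 1 → EuclideanSpace ℝ (Fin d))) (hder 1)
    simpa only [iteratedFDeriv_one_apply] using this
  have hτ0' : τ' 0 ∈ Metric.ball (0 : EuclideanSpace ℝ (Fin d)) r₁' := by
    rw [hτ', Function.comp_apply, normalMap_zero]
    exact normalCoord_mem_ball hr₁0' hr₁' hp'
  have hφ : ContMDiffAt (𝓡 d) (𝓡 d) ∞ (normalMap β₁') (τ' 0) :=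
    (contMDiffOn_normalMap hr₁').contMDiffAt (Metric.isOpen_ball.mem_nhds hτ0')
  -- near the origin the second normal map is `normalMap β₁' ∘ τ'`
  have hloc : normalMap β₂' =ᶠ[𝓝 0] normalMap β₁' ∘ τ' := by
    have hcont : ContinuousAt (normalMap β₂') 0 :=
      ((contMDiffOn_normalMap hr₂').contMDiffAt (Metric.ball_mem_nhds 0 hr₂0')).continuousAt
    have hmem : ∀ᶠ y in 𝓝 0, normalMap β₂' y ∈ Metric.ball β₁'.pt r₁' :=
      hcont.eventually_mem (Metric.isOpen_ball.mem_nhds (by rwa [normalMap_zero]))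
    filter_upwards [hmem] with y hy
    exact (normalMap_normalCoord hr₁0' hr₁' hy).symm
  have h0 : normalMap β₂' 0 = (normalMap β₁' ∘ τ) 0 := by
    rw [hloc.self_of_nhds, Function.comp_apply, Function.comp_apply, e0]
  have hz : normalMap β₂' 0 ∈ (extChartAt (𝓡 d) β₂'.pt).source := by
    rw [normalMap_zero]; exact mem_extChartAt_source _
  change normalMap β₂' =ᶠ[𝓝 0] normalMap β₁' ∘ τ
  refine eventuallyEq_of_pullbackForm_eq (z₀ := β₂'.pt)
    ((contMDiffOn_normalMap hr₂').contMDiffAt (Metric.ball_mem_nhds 0 hr₂0')) ?_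
    (injective_mfderiv_normalMap hr₂0' hr₂' (Metric.mem_ball_self hr₂0')) hform h0 hz ?_
  · exact ContMDiffAt.comp 0 (by rw [e0]; exact hφ) cτ.contMDiffAt
  · refine Eq.trans (hloc.fun_comp (extChartAt (𝓡 d) β₂'.pt)).fderiv_eq ?_
    have hz' : normalMap β₁' (τ' 0) ∈ (extChartAt (𝓡 d) β₂'.pt).source := by
      have := hloc.self_of_nhds
      rw [this] at hz
      exact hz
    have hg : DifferentiableAt ℝ (fun y => extChartAt (𝓡 d) β₂'.pt (normalMap β₁' y)) (τ' 0) :=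
      (contDiffAt_extChartAt_comp hφ hz').differentiableAt (by simp)
    have c1 := fderiv_comp (g := fun y => extChartAt (𝓡 d) β₂'.pt (normalMap β₁' y)) 0 hg
      (cτ'.differentiableAt (by simp))
    have c2 := fderiv_comp (g := fun y => extChartAt (𝓡 d) β₂'.pt (normalMap β₁' y)) (f := τ) 0
      (by rw [e0]; exact hg) (cτ.differentiableAt (by simp))
    rw [e0, e1] at c2
    exact c1.trans c2.symm

variable [IsRiemannianManifold (𝓡 d) M] [IsRiemannianManifold (𝓡 d) N] [CompleteSpace N]

/-- The correspondences of normal coordinates agree on the intersection of the balls. A path of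
length less than `δ` from `β₂.pt` to a common point stays in the domains of both isometries, so
their agreement near `β₂.pt` propagates along it. -/
theorem normalCorrespondence_eq_of_mem_inter (hδ : 0 < δ) (h₁ : 2 * δ < r₁) (h₂ : 2 * δ < r₂)
    (h₁' : 2 * δ < r₁') (h₂' : 2 * δ < r₂')
    (hr₁ : IsExpDiffeo d β₁.pt r₁) (hr₂ : IsExpDiffeo d β₂.pt r₂)
    (hr₁' : IsExpDiffeo d β₁'.pt r₁') (hr₂' : IsExpDiffeo d β₂'.pt r₂')
    (hS₁ : metricSeries β₁ = metricSeries β₁') (hS₂ : metricSeries β₂ = metricSeries β₂')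
    (hp : dist β₂.pt β₁.pt < 2 * δ) (hp' : dist β₂'.pt β₁'.pt < 2 * δ)
    (hT : transitionSeries β₁ β₂ = transitionSeries β₁' β₂') {q : M}
    (hq₁ : q ∈ Metric.ball β₁.pt δ) (hq₂ : q ∈ Metric.ball β₂.pt δ) :
    normalCorrespondence β₁ β₁' q = normalCorrespondence β₂ β₂' q := by
  have p₁ : 0 < r₁ := by linarith
  have p₂ : 0 < r₂ := by linarith
  have p₁' : 0 < r₁' := by linarith
  have p₂' : 0 < r₂' := by linarith
  have m₁ := fun x hx hx' => pullbackForm_normalMap_eq (v := x) hr₁ hr₁' hS₁ hx hx'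
  have m₂ := fun x hx hx' => pullbackForm_normalMap_eq (v := x) hr₂ hr₂' hS₂ hx hx'
  have hsub : Metric.ball β₁.pt (2 * δ) ⊆ commonDomain β₁ r₁ r₁' :=
    ball_subset_commonDomain p₁ p₁' hr₁ hr₁' m₁ h₁.le h₁'.le
  -- in the normal coordinates of `β₂` both isometries are defined on `U`
  let U : Set (EuclideanSpace ℝ (Fin d)) :=
    (Metric.ball 0 r₂ ∩ normalMap β₂ ⁻¹' Metric.ball β₁.pt (2 * δ)) ∩ Metric.ball 0 r₂'
  have hU : IsOpen U := ((contMDiffOn_normalMap hr₂).continuousOn.isOpen_inter_preimage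
    Metric.isOpen_ball Metric.isOpen_ball).inter Metric.isOpen_ball
  let F := normalCorrespondence β₁ β₁' ∘ normalMap β₂
  have hφ₂ : ∀ x ∈ U, ContMDiffAt (𝓡 d) (𝓡 d) ∞ (normalMap β₂) x := fun x hx =>
    (contMDiffOn_normalMap hr₂).contMDiffAt (Metric.isOpen_ball.mem_nhds hx.1.1)
  have hf₁ : ∀ x ∈ U, ContMDiffAt (𝓡 d) (𝓡 d) ∞ (normalCorrespondence β₁ β₁') (normalMap β₂ x) :=
    fun x hx => contMDiffAt_normalCorrespondence p₁ hr₁ hr₁' (hsub hx.1.2)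
  have hform : ∀ x ∈ U, pullbackForm (normalMap β₂') x = pullbackForm F x := by
    intro x hx
    rw [← m₂ x hx.1.1 hx.2]
    ext u w
    rw [pullbackForm_apply, pullbackForm_apply, mfderiv_comp x
      ((hf₁ x hx).mdifferentiableAt (by simp)) ((hφ₂ x hx).mdifferentiableAt (by simp))]
    exact (inner_mfderiv_normalCorrespondence p₁ hr₁ hr₁' m₁ (hsub hx.1.2) _ _).symm
  have h0U : (0 : EuclideanSpace ℝ (Fin d)) ∈ U := by
    refine ⟨⟨Metric.mem_ball_self p₂, ?_⟩, Metric.mem_ball_self p₂'⟩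
    rw [mem_preimage, normalMap_zero]
    exact hp
  have hstart : normalMap β₂' =ᶠ[𝓝 0] F :=
    normalCorrespondence_comp_normalMap_eventuallyEq p₁ p₂ p₁' p₂' hr₁ hr₂ hr₁' hr₂'
      (hp.trans h₁) (hp'.trans h₁') hT
      (by filter_upwards [hU.mem_nhds h0U] with y hy using hform y hy)
  obtain ⟨γ, g0, g1, hγ, hl⟩ := exists_path_of_mem_ball (d := d) hq₂
  have hl' : ∀ r, 2 * δ < r → pathELength (𝓡 d) γ 0 1 < ENNReal.ofReal r := fun r hr =>
    hl.trans_le (ENNReal.ofReal_le_ofReal (by linarith))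
  have hmem : ∀ t ∈ Icc (0 : ℝ) 1, γ t ∈ commonDomain β₂ r₂ r₂' := fun t ht =>
    path_mem_commonDomain p₂ p₂' hr₂ hr₂' m₂ hγ g0 (hl' _ h₂) (hl' _ h₂') ht
  let c : ℝ → EuclideanSpace ℝ (Fin d) := fun t => normalCoord β₂ (γ t)
  have hc : ContinuousOn c (Icc 0 1) :=
    (contMDiffOn_normalCoord p₂ hr₂).continuousOn.comp hγ.continuous.continuousOn
      fun t ht => (hmem t ht).1
  have hφc : ∀ t ∈ Icc (0 : ℝ) 1, normalMap β₂ (c t) = γ t := fun t ht =>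
    normalMap_normalCoord p₂ hr₂ (hmem t ht).1
  have hcU : ∀ t ∈ Icc (0 : ℝ) 1, c t ∈ U := by
    intro t ht
    refine ⟨⟨normalCoord_mem_ball p₂ hr₂ (hmem t ht).1, ?_⟩, (hmem t ht).2⟩
    rw [mem_preimage, hφc t ht, Metric.mem_ball]
    have a1 := path_mem_ball_right hγ hl ht
    rw [g1, Metric.mem_ball] at a1
    rw [Metric.mem_ball] at hq₁
    have a2 := dist_triangle (γ t) q β₁.pt
    linarith
  have hc0 : c 0 = 0 := by
    simp only [c, g0]
    exact normalCoord_pt p₂ hr₂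
  have hfin := eq_of_pullbackForm_eq_of_path (F₁ := normalMap β₂') (F₂ := F) hU
    (fun x hx => ((contMDiffOn_normalMap hr₂').contMDiffAt
      (Metric.isOpen_ball.mem_nhds hx.2)).contMDiffWithinAt)
    (fun x hx => ((hf₁ x hx).comp x (hφ₂ x hx)).contMDiffWithinAt)
    (fun x hx => injective_mfderiv_normalMap p₂' hr₂' hx.2) hform hc hcU
    (by rw [hc0]; exact hstart)
  have e : normalMap β₂ (c 1) = q := by rw [hφc 1 ⟨zero_le_one, le_rfl⟩, g1]
  change normalMap β₂' (c 1) = normalCorrespondence β₁ β₁' (normalMap β₂ (c 1)) at hfin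
  rw [e] at hfin
  simp only [c, g1] at hfin
  exact hfin.symm

end Overlap

end RiemGeom

/-! ### Gluing -/

namespace RiemGeom
open Set Filter Manifold

section Gluing

variable {d : ℕ} {M : Type*} [MetricSpace M] [ChartedSpace (EuclideanSpace ℝ (Fin d)) M]
  [IsManifold (𝓡 d) ω M] [RiemannianBundle (fun x : M => TangentSpace (𝓡 d) x)]
  {N : Type*} [MetricSpace N] [ChartedSpace (EuclideanSpace ℝ (Fin d)) N]
  [IsManifold (𝓡 d) ω N] [RiemannianBundle (fun x : N => TangentSpace (𝓡 d) x)]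

omit [IsManifold (𝓡 d) ω M] [IsManifold (𝓡 d) ω N]
  [RiemannianBundle (fun x : M => TangentSpace (𝓡 d) x)] in
lemma inner_mfderiv_congr {f g : M → N} {x : M} (h : f =ᶠ[𝓝 x] g) (v w : TangentSpace (𝓡 d) x) :
    inner ℝ (mfderiv (𝓡 d) (𝓡 d) f x v : TangentSpace (𝓡 d) (f x))
        (mfderiv (𝓡 d) (𝓡 d) f x w : TangentSpace (𝓡 d) (f x))
      = inner ℝ (mfderiv (𝓡 d) (𝓡 d) g x v : TangentSpace (𝓡 d) (g x))
        (mfderiv (𝓡 d) (𝓡 d) g x w : TangentSpace (𝓡 d) (g x)) := by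
  rw [h.mfderiv_eq (I := 𝓡 d) (I' := 𝓡 d)]
  -- the tangent spaces at `f x` and `g x` are the same type; only the inner product involves the
  -- base point
  let a : EuclideanSpace ℝ (Fin d) := mfderiv (𝓡 d) (𝓡 d) g x v
  let b : EuclideanSpace ℝ (Fin d) := mfderiv (𝓡 d) (𝓡 d) g x w
  have key : ∀ p q : N, p = q →
      inner ℝ (show TangentSpace (𝓡 d) p from a) (show TangentSpace (𝓡 d) p from b)
        = inner ℝ (show TangentSpace (𝓡 d) q from a) (show TangentSpace (𝓡 d) q from b) := by
    rintro p q rfl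
    rfl
  exact key _ _ h.self_of_nhds

omit [IsManifold (𝓡 d) ω M] [IsManifold (𝓡 d) ω N] in
/-- A map that agrees on each member of an open cover with a local isometry is a local isometry. -/
lemma IsLocalIsometryOn.of_eqOn_iUnion {ι : Type*} {U : ι → Set M} (hU : ∀ i, IsOpen (U i))
    {f : M → N} {F : ι → M → N} (hF : ∀ i, IsLocalIsometryOn d (F i) (U i))
    (hf : ∀ i, EqOn f (F i) (U i)) : IsLocalIsometryOn d f (⋃ i, U i) := by
  have hev : ∀ i, ∀ x ∈ U i, f =ᶠ[𝓝 x] F i := fun i x hx => (hf i).eventuallyEq_of_mem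
    ((hU i).mem_nhds hx)
  refine ⟨fun x hx => ?_, fun x hx v w => ?_⟩
  · obtain ⟨i, hi⟩ := mem_iUnion.1 hx
    exact (((hF i).1.contMDiffAt ((hU i).mem_nhds hi)).congr_of_eventuallyEq
      (hev i x hi)).contMDiffWithinAt
  · obtain ⟨i, hi⟩ := mem_iUnion.1 hx
    rw [inner_mfderiv_congr (hev i x hi)]
    exact (hF i).2 x hi v w

omit [IsManifold (𝓡 d) ω M] in
/-- Below half the injectivity radius, the exponential map is a diffeomorphism on a ball of more
than twice the radius. -/
lemma exists_isExpDiffeo_of_lt_injRad {p : M} {δ : ℝ} (hδ : 0 < δ)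
    (h : ENNReal.ofReal δ < injRad d p / 2) : ∃ r, 2 * δ < r ∧ IsExpDiffeo d p r := by
  have h2 : ENNReal.ofReal (2 * δ) < injRad d p := by
    rw [ENNReal.lt_div_iff_mul_lt (by simp) (by simp)] at h
    rwa [mul_comm, ENNReal.ofReal_mul hδ.le, ENNReal.ofReal_ofNat]
  obtain ⟨_, ⟨r, ⟨hr0, hr⟩, rfl⟩, hlt⟩ := lt_sSup_iff.1 h2
  exact ⟨r, (ENNReal.ofReal_lt_ofReal_iff hr0).1 hlt, hr⟩

end Gluing

end RiemGeom

end

theorem mainTheorem8 {d : ℕ}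
    {M : Type*} [MetricSpace M] [ChartedSpace (EuclideanSpace ℝ (Fin d)) M]
    [IsManifold (𝓡 d) ω M] [RiemannianBundle (fun x : M => TangentSpace (𝓡 d) x)]
    [IsContMDiffRiemannianBundle (𝓡 d) ω (EuclideanSpace ℝ (Fin d))
      (fun x : M => TangentSpace (𝓡 d) x)]
    [IsRiemannianManifold (𝓡 d) M] [CompleteSpace M] [ConnectedSpace M]
    {N : Type*} [MetricSpace N] [ChartedSpace (EuclideanSpace ℝ (Fin d)) N]
    [IsManifold (𝓡 d) ω N] [RiemannianBundle (fun x : N => TangentSpace (𝓡 d) x)]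
    [IsContMDiffRiemannianBundle (𝓡 d) ω (EuclideanSpace ℝ (Fin d))
      (fun x : N => TangentSpace (𝓡 d) x)]
    [IsRiemannianManifold (𝓡 d) N] [CompleteSpace N] [ConnectedSpace N]
    {m : ℕ} (β : Fin m → RiemGeom.Frame d M) (β' : Fin m → RiemGeom.Frame d N)
    (δ : ℝ) (hδ : 0 < δ)
    (hinj : ∀ i, ENNReal.ofReal δ < RiemGeom.injRad d (β i).pt / 2)
    (hinj' : ∀ i, ENNReal.ofReal δ < RiemGeom.injRad d (β' i).pt / 2)
    (hdistinct : Function.Injective (fun i => (β i).pt))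
    (hdistinct' : Function.Injective (fun i => (β' i).pt))
    (hS : ∀ i, RiemGeom.metricSeries (β i) = RiemGeom.metricSeries (β' i))
    (hinter : ∀ i j,
      (Metric.ball (β i).pt δ ∩ Metric.ball (β j).pt δ).Nonempty ↔
        (Metric.ball (β' i).pt δ ∩ Metric.ball (β' j).pt δ).Nonempty)
    (hT : ∀ i j, (Metric.ball (β i).pt δ ∩ Metric.ball (β j).pt δ).Nonempty →
      RiemGeom.transitionSeries (β i) (β j) = RiemGeom.transitionSeries (β' i) (β' j)) :
    (∀ i, RiemGeom.normalCorrespondence (β i) (β' i) '' Metric.ball (β i).pt δ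
        = Metric.ball (β' i).pt δ) ∧
    ∃ f : M → N,
      (∀ i, Set.EqOn f (RiemGeom.normalCorrespondence (β i) (β' i))
        (Metric.ball (β i).pt δ)) ∧
      f '' (⋃ i, Metric.ball (β i).pt δ) = ⋃ i, Metric.ball (β' i).pt δ ∧
      RiemGeom.IsLocalIsometryOn d f (⋃ i, Metric.ball (β i).pt δ) := by
  classical
  choose r h2r hr using fun i => RiemGeom.exists_isExpDiffeo_of_lt_injRad hδ (hinj i)
  choose r' h2r' hr' using fun i => RiemGeom.exists_isExpDiffeo_of_lt_injRad hδ (hinj' i)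
  have r0 : ∀ i, 0 < r i := fun i => by linarith [h2r i]
  have r0' : ∀ i, 0 < r' i := fun i => by linarith [h2r' i]
  have hm := fun i x hx hx' => RiemGeom.pullbackForm_normalMap_eq (v := x) (hr i) (hr' i) (hS i)
    hx hx'
  have himage : ∀ i, RiemGeom.normalCorrespondence (β i) (β' i) '' Metric.ball (β i).pt δ
      = Metric.ball (β' i).pt δ := fun i =>
    RiemGeom.image_normalCorrespondence_ball (r0 i) (r0' i) (hr i) (hr' i) (hm i)
      (by linarith [h2r i]) (by linarith [h2r' i])
  have hisom : ∀ i, RiemGeom.IsLocalIsometryOn d (RiemGeom.normalCorrespondence (β i) (β' i))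
      (Metric.ball (β i).pt δ) := by
    intro i
    have hsub := RiemGeom.ball_subset_commonDomain (s := δ) (r0 i) (r0' i) (hr i) (hr' i) (hm i)
      (by linarith [h2r i]) (by linarith [h2r' i])
    exact ⟨fun x hx => (RiemGeom.contMDiffAt_normalCorrespondence (r0 i) (hr i) (hr' i)
        (hsub hx)).contMDiffWithinAt,
      fun x hx v w => RiemGeom.inner_mfderiv_normalCorrespondence (r0 i) (hr i) (hr' i) (hm i)
        (hsub hx) v w⟩
  have hagree : ∀ i j x, x ∈ Metric.ball (β i).pt δ → x ∈ Metric.ball (β j).pt δ →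
      RiemGeom.normalCorrespondence (β i) (β' i) x
        = RiemGeom.normalCorrespondence (β j) (β' j) x := by
    intro i j x hi hj
    have hne : (Metric.ball (β i).pt δ ∩ Metric.ball (β j).pt δ).Nonempty := ⟨x, hi, hj⟩
    obtain ⟨y, yi, yj⟩ := (hinter i j).1 hne
    refine RiemGeom.normalCorrespondence_eq_of_mem_inter hδ (h2r i) (h2r j) (h2r' i) (h2r' j)
      (hr i) (hr j) (hr' i) (hr' j) (hS i) (hS j) ?_ ?_ (hT i j hne) hi hj
    · rw [Metric.mem_ball] at hi hj
      linarith [dist_triangle_left (β j).pt (β i).pt x]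
    · rw [Metric.mem_ball] at yi yj
      linarith [dist_triangle_left (β' j).pt (β' i).pt y]
  -- the value off the union of the balls is irrelevant
  let f : M → N := fun x =>
    if h : ∃ i, x ∈ Metric.ball (β i).pt δ then
      RiemGeom.normalCorrespondence (β h.choose) (β' h.choose) x
    else Classical.arbitrary N
  have hf : ∀ i, Set.EqOn f (RiemGeom.normalCorrespondence (β i) (β' i))
      (Metric.ball (β i).pt δ) := by
    intro i x hx
    have h : ∃ i, x ∈ Metric.ball (β i).pt δ := ⟨i, hx⟩
    simp only [f, dif_pos h]
    exact hagree _ _ x h.choose_spec hx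
  refine ⟨himage, f, hf, ?_, ?_⟩
  · rw [Set.image_iUnion]
    exact Set.iUnion_congr fun i => (hf i).image_eq.trans (himage i)
  · exact RiemGeom.IsLocalIsometryOn.of_eqOn_iUnion (fun i => Metric.isOpen_ball) hisom hf
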